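/- Links are unoriented tame links in $\mathbb{R}^3$, considered up to ambient isotopy and represented by plane diagrams up to Reidemeister moves. For $n\ge 1$, an $n$-move (respectively a $(-n)$-move) on a link replaces two parallel strands inside a disk of a diagram by $n$ right-handed (respectively left-handed) half twists of these strands, and leaves the link unchanged outside the disk. Two links are $n$-move equivalent if one can be obtained from the other by finitely many $n$-moves, $(-n)$-moves and isotopies. A link is a closed 3-braid if it is isotopic to the standard closure of a braid on three strands, that is, of a word in the generators $\sigma_1,\sigma_2$ and their inverses. **Theorem 1.14.** (i) Every knot which is a closed 3-braid is 4-move equivalent to the trivial knot. (ii) Every link of two components which is a closed 3-braid is 4-move equivalent to the trivial link of two components or to the Hopf link. (iii) Every link of three components which is a closed 3-braid is 4-move equivalent to the trivial link of three components, or to the split union of the Hopf link and a trivial knot, or to the connected sum of two Hopf links, or to the $(3,3)$-torus link (the closure of $(\sigma_1\sigma_2)^3$), or to the Borromean rings (the closure of $(\sigma_1\sigma_2^{-1})^3$). -/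

import Mathlib

/-!
# Link diagrams, Reidemeister moves and n-moves

A link in 3-space is given by a plane diagram. A plane diagram in general position with respect to
the height function is cut by horizontal lines into slices, each containing exactly one local
minimum, one local maximum or one crossing, next to vertical strands. It is therefore a finite word
of slices, listed from the bottom to the top. Two such words are diagrams of the same (unoriented)
link, up to ambient isotopy of 3-space, exactly when they are related by the planar isotopies and
the three Reidemeister moves listed below.
-/

namespace LinkDiagram

/-- What happens in a slice, besides vertical strands. -/
inductive Kind where
  /-- a local minimum, where two new strands begin -/
  | cup
  /-- a local maximum, where two neighbouring strands end -/
  | cap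
  /-- a crossing of two neighbouring strands; `cross true` is a positive generator `σ` (the strand
  going from the lower left to the upper right is the overpass) and `cross false` is its inverse -/
  | cross (s : Bool)

/-- The number of strands that enter the active part of a slice from below. -/
def Kind.bot : Kind → ℕ
  | .cup => 0
  | .cap => 2
  | .cross _ => 2

/-- The number of strands that leave the active part of a slice at the top. -/
def Kind.top : Kind → ℕ
  | .cup => 2
  | .cap => 0
  | .cross _ => 2

/-- A slice: its kind and the number of vertical strands to the left of its active part. The
number of strands to the right is determined by the total number of strands. -/
structure Slice where
  kind : Kind
  pos : ℕ

def cup (i : ℕ) : Slice := ⟨.cup, i⟩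
def cap (i : ℕ) : Slice := ⟨.cap, i⟩

/-- A crossing of the strands number `i` and `i + 1` (strands are counted from `0`, from the left).
-/
def cross (s : Bool) (i : ℕ) : Slice := ⟨.cross s, i⟩

/-- The number of strands above the slice, if there are `n` strands below it. -/
def Slice.next (x : Slice) (n : ℕ) : ℕ := n - x.kind.bot + x.kind.top

/-- `IsTangle n w m`: the slices of `w` can be stacked, in this order from bottom to top, on `n`
strands, and leave `m` strands at the top. -/
def IsTangle : ℕ → List Slice → ℕ → Prop
  | n, [], m => n = m
  | n, x :: w, m => x.pos + x.kind.bot ≤ n ∧ IsTangle (x.next n) w m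

instance instDecidableIsTangle : (n : ℕ) → (w : List Slice) → (m : ℕ) → Decidable (IsTangle n w m)
  | n, [], m => inferInstanceAs (Decidable (n = m))
  | n, x :: w, m =>
    have := instDecidableIsTangle (x.next n) w m
    inferInstanceAs (Decidable (x.pos + x.kind.bot ≤ n ∧ IsTangle (x.next n) w m))

theorem IsTangle.append {a b c : ℕ} {u v : List Slice} (hu : IsTangle a u b)
    (hv : IsTangle b v c) : IsTangle a (u ++ v) c := by
  induction u generalizing a with
  | nil => cases hu; exact hv
  | cons x u ih => exact ⟨hu.1, ih hu.2⟩

end LinkDiagram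

/-- A link diagram: a word of slices that begins and ends with no strands. -/
def LinkDiagram : Type := {w : List LinkDiagram.Slice // LinkDiagram.IsTangle 0 w 0}

namespace LinkDiagram

/-! ### Components -/

/-- The number of strands at the horizontal line above the first `k` slices. -/
def widthAt (w : List Slice) (k : ℕ) : ℕ := (w.take k).foldl (fun n x => x.next n) 0

/-- The points where the link meets the horizontal lines between slices: `(k, j)` is the point
number `j`, from the left, on the line above the first `k` slices. -/
def Point (w : List Slice) : Type := {p : ℕ × ℕ // p.1 ≤ w.length ∧ p.2 < widthAt w p.1}

/-- Two points are joined by an arc of the diagram inside a single slice. -/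
inductive Joined (w : List Slice) : ℕ × ℕ → ℕ × ℕ → Prop
  | left (k : ℕ) (x : Slice) (j : ℕ) : w[k]? = some x → j < x.pos → Joined w (k, j) (k + 1, j)
  | right (k : ℕ) (x : Slice) (j : ℕ) : w[k]? = some x →
      Joined w (k, x.pos + x.kind.bot + j) (k + 1, x.pos + x.kind.top + j)
  | cup (k i : ℕ) : w[k]? = some (cup i) → Joined w (k + 1, i) (k + 1, i + 1)
  | cap (k i : ℕ) : w[k]? = some (cap i) → Joined w (k, i) (k, i + 1)
  | crossLeft (k i : ℕ) (s : Bool) : w[k]? = some (cross s i) → Joined w (k, i) (k + 1, i + 1)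
  | crossRight (k i : ℕ) (s : Bool) : w[k]? = some (cross s i) → Joined w (k, i + 1) (k + 1, i)

/-- The number of components of a link: the number of classes of points for the equivalence
relation generated by being joined by an arc. -/
noncomputable def numComponents (L : LinkDiagram) : ℕ :=
  Nat.card (Quot fun p q : Point L.1 => Joined L.1 p.1 q.1)

/-! ### Moves -/

/-- The local form of the moves between diagrams of the same link: planar isotopies (`commute`,
`zigzag`, `slide`) and Reidemeister moves. The other variants of the Reidemeister moves are
compositions of these. -/
inductive ReidemeisterMove : List Slice → List Slice → Prop
  /-- two slices whose active parts lie side by side may exchange their heights -/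
  | commute (x y : Kind) (i k : ℕ) :
      ReidemeisterMove [⟨x, i⟩, ⟨y, i + x.top + k⟩] [⟨y, i + x.bot + k⟩, ⟨x, i⟩]
  /-- a local minimum followed by a local maximum on the same strand may be straightened -/
  | zigzagLeft (i : ℕ) : ReidemeisterMove [cup i, cap (i + 1)] []
  | zigzagRight (i : ℕ) : ReidemeisterMove [cup (i + 1), cap i] []
  /-- a strand that crosses a minimum (maximum) on one side of it may be moved to the other side -/
  | slideCup (s : Bool) (i : ℕ) :
      ReidemeisterMove [cup i, cross s (i + 1)] [cup (i + 1), cross (!s) i]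
  | slideCap (s : Bool) (i : ℕ) :
      ReidemeisterMove [cross s (i + 1), cap i] [cross (!s) i, cap (i + 1)]
  /-- first Reidemeister move -/
  | r1Cup (s : Bool) (i : ℕ) : ReidemeisterMove [cup i, cross s i] [cup i]
  | r1Cap (s : Bool) (i : ℕ) : ReidemeisterMove [cross s i, cap i] [cap i]
  /-- second Reidemeister move -/
  | r2 (s : Bool) (i : ℕ) : ReidemeisterMove [cross s i, cross (!s) i] []
  /-- third Reidemeister move -/
  | r3 (s : Bool) (i : ℕ) :
      ReidemeisterMove [cross s i, cross s (i + 1), cross s i]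
        [cross s (i + 1), cross s i, cross s (i + 1)]

/-- The local form of the `n`-moves and the `-n`-moves: two parallel strands are replaced by `n`
half twists, of either handedness. -/
inductive TwistMove (n : ℕ) : List Slice → List Slice → Prop
  | twist (s : Bool) (i : ℕ) : TwistMove n [] (List.replicate n (cross s i))

/-- `L'` arises from `L` by replacing a part of the word according to the local move `R`; the rest
of the diagram is unchanged. -/
def Step (R : List Slice → List Slice → Prop) (L L' : LinkDiagram) : Prop :=
  ∃ u a b v : List Slice, R a b ∧ L.1 = u ++ a ++ v ∧ L'.1 = u ++ b ++ v

/-- Two diagrams represent the same link. -/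
def Isotopic : LinkDiagram → LinkDiagram → Prop :=
  Relation.EqvGen (Step ReidemeisterMove)

/-- `n`-move equivalence: one link is obtained from the other by finitely many `n`-moves, `-n`-moves
and isotopies. -/
def MoveEquiv (n : ℕ) : LinkDiagram → LinkDiagram → Prop :=
  Relation.EqvGen fun L L' => Step ReidemeisterMove L L' ∨ Step (TwistMove n) L L'

/-! ### Closed braids -/

/-- Words in the standard generators of the braid group on `n` strands and their inverses:
`(i, true)` is `σ_{i+1}` and `(i, false)` is its inverse. -/
abbrev BraidWord (n : ℕ) : Type := List (Fin (n - 1) × Bool)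

/-- The word of slices of the standard closure of a braid: `n` nested minima, the braid on the first
`n` of the `2 n` strands, and `n` nested maxima. -/
def closureWord (n : ℕ) (β : BraidWord n) : List Slice :=
  (List.range n).map cup ++ β.map (fun g => cross g.2 g.1) ++ (List.range n).reverse.map cap

theorem isTangle_cups (n : ℕ) : IsTangle 0 ((List.range n).map cup) (2 * n) := by
  induction n with
  | zero => rfl
  | succ n ih =>
    rw [List.range_succ, List.map_append]
    refine ih.append ⟨?_, ?_⟩
    · change n + 0 ≤ 2 * n
      omega
    · change 2 * n - 0 + 2 = 2 * (n + 1)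
      omega

theorem isTangle_caps (n : ℕ) : IsTangle (2 * n) ((List.range n).reverse.map cap) 0 := by
  induction n with
  | zero => rfl
  | succ n ih =>
    rw [List.range_succ, List.reverse_append]
    refine ⟨?_, ?_⟩
    · change n + 2 ≤ 2 * (n + 1)
      omega
    · have h : (cap n).next (2 * (n + 1)) = 2 * n := by
        change 2 * (n + 1) - 2 + 0 = 2 * n
        omega
      change IsTangle ((cap n).next (2 * (n + 1))) _ 0
      rw [h]
      exact ih

theorem isTangle_braid (n : ℕ) (β : BraidWord n) :
    IsTangle (2 * n) (β.map (fun g => cross g.2 g.1)) (2 * n) := by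
  induction β with
  | nil => rfl
  | cons g β ih =>
    have hg := g.1.2
    refine ⟨?_, ?_⟩
    · change (g.1 : ℕ) + 2 ≤ 2 * n
      omega
    · have h : (cross g.2 g.1).next (2 * n) = 2 * n := by
        change 2 * n - 2 + 2 = 2 * n
        omega
      rw [h]
      exact ih

/-- The closure of a braid. -/
def closure (n : ℕ) (β : BraidWord n) : LinkDiagram :=
  ⟨closureWord n β, ((isTangle_cups n).append (isTangle_braid n β)).append (isTangle_caps n)⟩

/-- The link is a closed braid on `n` strands. -/
def IsClosedBraid (n : ℕ) (L : LinkDiagram) : Prop :=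
  ∃ β : BraidWord n, Isotopic L (closure n β)

/-! ### Particular links -/

/-- The split union: the second diagram is put above the first. -/
def splitUnion (L L' : LinkDiagram) : LinkDiagram := ⟨L.1 ++ L'.1, L.2.append L'.2⟩

/-- The trivial knot: a circle without crossings. -/
def unknot : LinkDiagram := ⟨[cup 0, cap 0], by decide⟩

/-- The trivial link of `n` components: `n` circles that bound disjoint disks in the plane. -/
def trivialLink : ℕ → LinkDiagram
  | 0 => ⟨[], rfl⟩
  | n + 1 => splitUnion (trivialLink n) unknot

/-- The Hopf link: two circles with two crossings, the closure of the braid `σ₁²`. -/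
def hopfLink : LinkDiagram := closure 2 [(0, true), (0, true)]

/-- The connected sum of two words of slices: the first diagram is cut open at its highest point,
the second one is put above it and cut open at its lowest point, and the ends are joined. -/
def connectedSumWord (u v : List Slice) : List Slice := u.dropLast ++ v.tail

/-- The connected sum of two Hopf links. -/
def hopfSum : LinkDiagram := ⟨connectedSumWord hopfLink.1 hopfLink.1, by decide⟩

/-- The torus link of type `(3, 3)`: the closure of the braid `(σ₁ σ₂)³`. -/
def torusLink33 : LinkDiagram :=
  closure 3 [(0, true), (1, true), (0, true), (1, true), (0, true), (1, true)]

/-- The Borromean rings: the closure of the braid `(σ₁ σ₂⁻¹)³`. -/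
def borromeanRings : LinkDiagram :=
  closure 3 [(0, true), (1, false), (0, true), (1, false), (0, true), (1, false)]

end LinkDiagram

/-!
An even move preserves the number of components, because it preserves the number `2 ^ c` of
colourings of the `c` components by two colours; unlike `c` itself, this number is a sum over the
slices of the diagram, which makes invariance local and the examples computable.

Up to 4-moves the closure of a 3-braid depends only on the conjugacy class of the braid in the
quotient of `B₃` by the fourth powers of its generators `a`, `b`. There `Δ² = (aba)²` has order
dividing 4, and conjugation by `b²` sends `a` to `a⁻¹Δ²`, so that every element is conjugate to
`rΔ²ʲ` with `r ∈ {1, a, a², a²b, ab}`. Further conjugations, stabilizations, and two moves of the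
strand closed innermost, which pull it from above the other two to below them, identify all the
closures of these elements.
-/

namespace LinkDiagram

/-! ### Counting components by colourings -/

section Colourings

variable {α : Type*}

/-- The colours of the `m` strands from number `i` on. -/
def window (i m : ℕ) (c : ℕ → α) : List α := (List.range m).map fun j => c (i + j)

/-- The colouring of strands obtained from `c` by replacing the `m` strands from number `i` on by
strands coloured by the list `t`. -/
def splice (i m : ℕ) (t : List α) (c : ℕ → α) (j : ℕ) : α :=
  if j < i then c j else t[j - i]?.getD (c (j - t.length + m))

theorem length_window (i m : ℕ) (c : ℕ → α) : (window i m c).length = m := by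
  simp only [window, List.length_map, List.length_range]

theorem getElem_window {i m j : ℕ} {c : ℕ → α} (hj : j < (window i m c).length) :
    (window i m c)[j] = c (i + j) := by
  simp only [window, List.getElem_map, List.getElem_range]

theorem splice_of_lt {i j : ℕ} (h : j < i) (m : ℕ) (t : List α) (c : ℕ → α) :
    splice i m t c j = c j :=
  if_pos h

theorem splice_add_of_lt (i m : ℕ) {t : List α} (c : ℕ → α) {j : ℕ} (h : j < t.length) :
    splice i m t c (i + j) = t[j] := by
  rw [splice, if_neg (Nat.le_add_right i j).not_gt, Nat.add_sub_cancel_left,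
    List.getElem?_eq_getElem h, Option.getD_some]

theorem splice_add_length_add (i m : ℕ) (t : List α) (c : ℕ → α) (k : ℕ) :
    splice i m t c (i + t.length + k) = c (i + m + k) := by
  have h : ¬ i + t.length + k < i := by omega
  have ht : t[i + t.length + k - i]? = none := List.getElem?_eq_none (by omega)
  rw [splice, if_neg h, ht, Option.getD_none]
  congr 1
  omega

theorem window_splice (i m : ℕ) (t : List α) (c : ℕ → α) :
    window i t.length (splice i m t c) = t :=
  List.ext_getElem (length_window ..) fun j hj h => by
    rw [getElem_window hj, splice_add_of_lt i m c h]

theorem window_splice_of_add_le {i n j : ℕ} (h : i + n ≤ j) (m : ℕ) (t : List α) (c : ℕ → α) :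
    window i n (splice j m t c) = window i n c := by
  refine List.map_congr_left fun l hl => splice_of_lt ?_ m t c
  rw [List.mem_range] at hl
  omega

theorem window_splice_add (i m k n : ℕ) (t : List α) (c : ℕ → α) :
    window (i + t.length + k) n (splice i m t c) = window (i + m + k) n c := by
  refine List.map_congr_left fun l _ => ?_
  rw [Nat.add_assoc _ k, splice_add_length_add, Nat.add_assoc _ k]

theorem splice_splice (i m k m' : ℕ) (t t' : List α) (c : ℕ → α) :
    splice (i + t.length + k) m' t' (splice i m t c) =
      splice i m t (splice (i + m + k) m' t' c) := by
  funext j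
  simp only [splice]
  grind

theorem splice_nil (i m : ℕ) (c : ℕ → α) (j : ℕ) :
    splice i m [] c j = if j < i then c j else c (j + m) :=
  rfl

theorem splice_pair (i m : ℕ) (a b : α) (c : ℕ → α) (j : ℕ) :
    splice i m [a, b] c j =
      if j < i then c j else if j = i then a else if j = i + 1 then b else c (j - 2 + m) := by
  rcases lt_or_ge j i with h | h
  · rw [splice_of_lt h, if_pos h]
  · obtain ⟨_ | _ | k, rfl⟩ := Nat.exists_eq_add_of_le h <;> simp [splice]

variable [Fintype α] [DecidableEq α]

/-- The possible colours of the strands above the active part of a slice, if the strands below it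
are coloured by a given list. -/
def Kind.tops : Kind → List α → Finset (List α)
  | .cup, _ => Finset.univ.map ⟨fun a => [a, a], fun _ _ h => (List.cons.inj h).1⟩
  | .cap, [a, b] => if a = b then {[]} else ∅
  | .cross _, [a, b] => {[b, a]}
  | _, _ => ∅

theorem Kind.length_of_mem_tops {x : Kind} {s t : List α} (h : t ∈ x.tops s) :
    t.length = x.top := by
  unfold Kind.tops at h
  split at h
  · obtain ⟨a, -, rfl⟩ := Finset.mem_map.1 h
    rfl
  all_goals grind [Kind.top]

theorem mem_tops_cup {a b : α} {s : List α} : [a, b] ∈ Kind.tops .cup s ↔ a = b :=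
  ⟨fun h => by obtain ⟨c, -, h⟩ := Finset.mem_map.1 h; cases h; rfl,
    fun h => Finset.mem_map.2 ⟨a, Finset.mem_univ a, h ▸ rfl⟩⟩

theorem nil_mem_tops_cap {a b : α} : [] ∈ Kind.tops .cap [a, b] ↔ a = b := by
  simp only [Kind.tops]
  split <;> simp [*]

theorem mem_tops_cross {s : Bool} {a b a' b' : α} :
    [a', b'] ∈ Kind.tops (.cross s) [a, b] ↔ a = b' ∧ b = a' := by
  simp [Kind.tops, eq_comm, and_comm]

/-- The transfer operator of a slice: it sums over the colourings of the strands above the slice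
that continue a colouring `c` of the strands below it. -/
def Slice.transfer (x : Slice) (F : (ℕ → α) → ℕ) (c : ℕ → α) : ℕ :=
  ∑ t ∈ x.kind.tops (window x.pos x.kind.bot c), F (splice x.pos x.kind.bot t c)

/-- The number of colourings of the word `w` that continue the colouring `c` of the strands below
it, where a colouring which ends in `d` counts `F d` times. -/
def transfer (w : List Slice) (F : (ℕ → α) → ℕ) : (ℕ → α) → ℕ :=
  w.foldr Slice.transfer F

theorem transfer_append (u v : List Slice) (F : (ℕ → α) → ℕ) :
    transfer (u ++ v) F = transfer u (transfer v F) :=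
  List.foldr_append

theorem transfer_cons (x : Slice) (w : List Slice) (F : (ℕ → α) → ℕ) :
    transfer (x :: w) F = x.transfer (transfer w F) :=
  rfl

theorem transfer_nil (F : (ℕ → α) → ℕ) : transfer [] F = F := rfl

theorem transfer_cup (i : ℕ) (F : (ℕ → α) → ℕ) (c : ℕ → α) :
    (cup i).transfer F c = ∑ a, F (splice i 0 [a, a] c) :=
  Finset.sum_map ..

theorem transfer_cap (i : ℕ) (F : (ℕ → α) → ℕ) (c : ℕ → α) :
    (cap i).transfer F c = if c i = c (i + 1) then F (splice i 2 [] c) else 0 := by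
  change ∑ t ∈ if c i = c (i + 1) then {[]} else ∅, _ = _
  split
  · exact Finset.sum_singleton ..
  · exact Finset.sum_empty

theorem transfer_cross (s : Bool) (i : ℕ) (F : (ℕ → α) → ℕ) (c : ℕ → α) :
    (cross s i).transfer F c = F (splice i 2 [c (i + 1), c i] c) :=
  Finset.sum_singleton ..

theorem transfer_commute (x y : Kind) (i k : ℕ) (F : (ℕ → α) → ℕ) :
    transfer [⟨x, i⟩, ⟨y, i + x.top + k⟩] F = transfer [⟨y, i + x.bot + k⟩, ⟨x, i⟩] F := by
  funext c
  have hx (t : List α) : window i x.bot (splice (i + x.bot + k) y.bot t c) = window i x.bot c :=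
    window_splice_of_add_le (Nat.le_add_right ..) ..
  simp only [transfer_cons, transfer_nil, Slice.transfer, hx]
  rw [Finset.sum_comm]
  refine Finset.sum_congr rfl fun s hs => ?_
  rw [← x.length_of_mem_tops hs, window_splice_add]
  simp only [splice_splice]

theorem transfer_cup_cap_succ (i : ℕ) (F : (ℕ → α) → ℕ) : transfer [cup i, cap (i + 1)] F = F := by
  funext c
  have h₁ (a : α) : splice i 0 [a, a] c (i + 1) = a := by simp [splice_pair]
  have h₂ (a : α) : splice i 0 [a, a] c (i + 1 + 1) = c i := by simp only [splice_pair]; grind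
  have h : splice (i + 1) 2 [] (splice i 0 [c i, c i] c) = c := by
    funext j; simp only [splice_nil, splice_pair]; grind
  simp only [transfer_cons, transfer_nil, transfer_cup, transfer_cap, h₁, h₂, Finset.sum_ite_eq',
    Finset.mem_univ, if_true, h]

theorem transfer_cup_succ_cap (i : ℕ) (F : (ℕ → α) → ℕ) : transfer [cup (i + 1), cap i] F = F := by
  funext c
  have h₁ (a : α) : splice (i + 1) 0 [a, a] c i = c i := by simp [splice_pair]
  have h₂ (a : α) : splice (i + 1) 0 [a, a] c (i + 1) = a := by simp [splice_pair]
  have h : splice i 2 [] (splice (i + 1) 0 [c i, c i] c) = c := by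
    funext j; simp only [splice_nil, splice_pair]; grind
  simp only [transfer_cons, transfer_nil, transfer_cup, transfer_cap, h₁, h₂, Finset.sum_ite_eq,
    Finset.mem_univ, if_true, h]

theorem transfer_cup_cross_succ (s : Bool) (i : ℕ) (F : (ℕ → α) → ℕ) :
    transfer [cup i, cross s (i + 1)] F = transfer [cup (i + 1), cross (!s) i] F := by
  funext c
  simp only [transfer_cons, transfer_nil, transfer_cup, transfer_cross]
  refine Finset.sum_congr rfl fun a _ => congrArg F (funext fun j => ?_)
  simp only [splice_pair]; grind

theorem transfer_cross_succ_cap (s : Bool) (i : ℕ) (F : (ℕ → α) → ℕ) :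
    transfer [cross s (i + 1), cap i] F = transfer [cross (!s) i, cap (i + 1)] F := by
  funext c
  have h : splice i 2 [] (splice (i + 1) 2 [c (i + 1 + 1), c (i + 1)] c) =
      splice (i + 1) 2 [] (splice i 2 [c (i + 1), c i] c) := by
    funext j; simp only [splice_nil, splice_pair]; grind
  simp only [transfer_cons, transfer_nil, transfer_cap, transfer_cross, h]
  congr 1
  simp only [splice_pair]; grind

theorem transfer_cup_cross (s : Bool) (i : ℕ) (F : (ℕ → α) → ℕ) :
    transfer [cup i, cross s i] F = transfer [cup i] F := by
  funext c
  simp only [transfer_cons, transfer_nil, transfer_cup, transfer_cross]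
  refine Finset.sum_congr rfl fun a _ => congrArg F (funext fun j => ?_)
  simp only [splice_pair]; grind

theorem transfer_cross_cap (s : Bool) (i : ℕ) (F : (ℕ → α) → ℕ) :
    transfer [cross s i, cap i] F = transfer [cap i] F := by
  funext c
  have h : splice i 2 [] (splice i 2 [c (i + 1), c i] c) = splice i 2 [] c := by
    funext j; simp only [splice_nil, splice_pair]; grind
  simp only [transfer_cons, transfer_nil, transfer_cap, transfer_cross, h]
  congr 1
  simp only [splice_pair]; grind

theorem transfer_cross_cross (s t : Bool) (i : ℕ) (F : (ℕ → α) → ℕ) :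
    transfer [cross s i, cross t i] F = F := by
  funext c
  simp only [transfer_cons, transfer_nil, transfer_cross]
  congr 1
  funext j
  simp only [splice_pair]; grind

theorem transfer_braid (s : Bool) (i : ℕ) (F : (ℕ → α) → ℕ) :
    transfer [cross s i, cross s (i + 1), cross s i] F =
      transfer [cross s (i + 1), cross s i, cross s (i + 1)] F := by
  funext c
  simp only [transfer_cons, transfer_nil, transfer_cross]
  congr 1
  funext j
  simp only [splice_pair]; grind

theorem transfer_eq_of_reidemeisterMove {a b : List Slice} (h : ReidemeisterMove a b)
    (F : (ℕ → α) → ℕ) : transfer a F = transfer b F := by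
  cases h with
  | commute x y i k => exact transfer_commute x y i k F
  | zigzagLeft i => exact transfer_cup_cap_succ i F
  | zigzagRight i => exact transfer_cup_succ_cap i F
  | slideCup s i => exact transfer_cup_cross_succ s i F
  | slideCap s i => exact transfer_cross_succ_cap s i F
  | r1Cup s i => exact transfer_cup_cross s i F
  | r1Cap s i => exact transfer_cross_cap s i F
  | r2 s i => exact transfer_cross_cross s (!s) i F
  | r3 s i => exact transfer_braid s i F

theorem transfer_replicate_cross {N : ℕ} (hN : Even N) (s : Bool) (i : ℕ) (F : (ℕ → α) → ℕ) :
    transfer (List.replicate N (cross s i)) F = F := by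
  obtain ⟨m, rfl⟩ := hN
  induction m with
  | zero => rfl
  | succ m ih =>
    rw [show m + 1 + (m + 1) = 2 + (m + m) by omega, List.replicate_add, transfer_append, ih]
    exact transfer_cross_cross s s i F

/-- The colouring `d` of the strands above the slice `x` continues the colouring `c` of the strands
below it. -/
def Slice.Fits (x : Slice) (c d : ℕ → α) : Prop :=
  (∀ j < x.pos, c j = d j) ∧ (∀ j, c (x.pos + x.kind.bot + j) = d (x.pos + x.kind.top + j)) ∧
    window x.pos x.kind.top d ∈ x.kind.tops (window x.pos x.kind.bot c)

theorem Slice.Fits.eq_splice {x : Slice} {c d : ℕ → α} (h : x.Fits c d) :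
    d = splice x.pos x.kind.bot (window x.pos x.kind.top d) c := by
  obtain ⟨hl, hr, -⟩ := h
  funext j
  rcases lt_or_ge j x.pos with hj | hj
  · rw [splice_of_lt hj, hl j hj]
  obtain ⟨j, rfl⟩ := Nat.exists_eq_add_of_le hj
  rcases lt_or_ge j x.kind.top with hj' | hj'
  · rw [splice_add_of_lt _ _ _ (by rwa [length_window]), getElem_window]
  · obtain ⟨k, rfl⟩ := Nat.exists_eq_add_of_le hj'
    have := splice_add_length_add x.pos x.kind.bot (window x.pos x.kind.top d) c k
    rw [length_window] at this
    rw [← Nat.add_assoc, this, hr]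

theorem Slice.fits_splice {x : Slice} {c : ℕ → α} {t : List α}
    (ht : t ∈ x.kind.tops (window x.pos x.kind.bot c)) :
    x.Fits c (splice x.pos x.kind.bot t c) := by
  have hlen := Kind.length_of_mem_tops ht
  refine ⟨fun j hj => (splice_of_lt hj ..).symm, fun j => ?_, ?_⟩
  · rw [← hlen, splice_add_length_add]
  · rwa [← hlen, window_splice]

/-- The colourings above a slice that continue `c` are given by the colours of the strands which
leave its active part. -/
def fitsEquiv (x : Slice) (c : ℕ → α) :
    {d // x.Fits c d} ≃ {t // t ∈ x.kind.tops (window x.pos x.kind.bot c)} where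
  toFun d := ⟨window x.pos x.kind.top d.1, d.2.2.2⟩
  invFun t := ⟨splice x.pos x.kind.bot t.1 c, Slice.fits_splice t.2⟩
  left_inv d := Subtype.ext d.2.eq_splice.symm
  right_inv t := Subtype.ext <| by
    simp only [← Kind.length_of_mem_tops t.2, window_splice]

theorem forall_fits_iff (w : List Slice) (g : ℕ → ℕ → α) :
    (∀ (k : ℕ) (x : Slice), w[k]? = some x → x.Fits (g k) (g (k + 1))) ↔
      ∀ p q, Joined w p q → g p.1 p.2 = g q.1 q.2 := by
  constructor
  · rintro h p q (⟨k, x, j, hx, hj⟩ | ⟨k, x, j, hx⟩ | ⟨k, i, hx⟩ | ⟨k, i, hx⟩ | ⟨k, i, s, hx⟩ |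
      ⟨k, i, s, hx⟩)
    · exact (h k x hx).1 j hj
    · exact (h k x hx).2.1 j
    · exact mem_tops_cup.1 (h k _ hx).2.2
    · exact nil_mem_tops_cap.1 (h k _ hx).2.2
    · exact (mem_tops_cross.1 (h k _ hx).2.2).1
    · exact (mem_tops_cross.1 (h k _ hx).2.2).2
  · intro h k x hx
    refine ⟨fun j hj => h _ _ (.left k x j hx hj), fun j => h _ _ (.right k x j hx), ?_⟩
    obtain ⟨_ | _ | s, i⟩ := x
    · exact mem_tops_cup.2 (h _ _ (.cup k i hx))
    · exact nil_mem_tops_cap.2 (h _ _ (.cap k i hx))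
    · exact mem_tops_cross.2 ⟨h _ _ (.crossLeft k i s hx), h _ _ (.crossRight k i s hx)⟩

variable [Inhabited α]

variable (α) in
/-- The number of colourings of the components of a diagram by elements of `α`. -/
def numColourings (L : LinkDiagram) : ℕ := transfer L.1 (fun _ : ℕ → α => 1) default

theorem numColourings_eq_of_moveEquiv {N : ℕ} (hN : Even N) {L L' : LinkDiagram}
    (h : MoveEquiv N L L') : numColourings α L = numColourings α L' := by
  induction h with
  | rel L L' h =>
    rcases h with ⟨u, a, b, v, h, hL, hL'⟩ | ⟨u, _, _, v, ⟨s, i⟩, hL, hL'⟩ <;>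
      simp only [numColourings, hL, hL', transfer_append]
    · rw [transfer_eq_of_reidemeisterMove h]
    · rw [transfer_replicate_cross hN, transfer_nil]
  | refl => rfl
  | symm _ _ _ ih => exact ih.symm
  | trans _ _ _ _ _ ih ih' => exact ih.trans ih'

/-- The colourings of a word of slices with the colouring `c` of the strands below it: `g k` is the
colouring of the horizontal line above the first `k` slices, and above the word, where there is no
such line, `g k` has the default value. -/
def Colouring (w : List Slice) (c : ℕ → α) : Type _ :=
  {g : ℕ → ℕ → α // g 0 = c ∧ (∀ (k : ℕ) (x : Slice), w[k]? = some x → x.Fits (g k) (g (k + 1))) ∧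
    ∀ k, w.length < k → g k = default}

instance (c : ℕ → α) : Unique (Colouring [] c) where
  default := ⟨fun k => Nat.casesOn k c default, rfl, by simp, by
    rintro (_ | k) hk
    · cases hk
    · rfl⟩
  uniq := by
    rintro ⟨g, hg, -, h⟩
    refine Subtype.ext (funext fun k => ?_)
    cases k with
    | zero => exact hg
    | succ k => exact h _ k.succ_pos

/-- A colouring of a nonempty word is a colouring of the line above the first slice together with a
colouring of the rest. -/
def colouringCons (x : Slice) (w : List Slice) (c : ℕ → α) :
    Colouring (x :: w) c ≃ Σ d : {d // x.Fits c d}, Colouring w d.1 where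
  toFun g := ⟨⟨g.1 1, by have := g.2.2.1 0 x rfl; rwa [g.2.1] at this⟩, fun k => g.1 (k + 1), rfl,
    fun k => g.2.2.1 (k + 1), fun k hk => g.2.2.2 (k + 1) (Nat.succ_lt_succ hk)⟩
  invFun p := ⟨fun k => Nat.casesOn k c p.2.1, rfl, by
    rintro (_ | k) y hy
    · cases hy
      have := p.1.2
      rwa [← p.2.2.1] at this
    · exact p.2.2.2.1 k y hy, by
    rintro (_ | k) hk
    · cases hk
    · exact p.2.2.2.2 k (Nat.lt_of_succ_lt_succ hk)⟩
  left_inv g := Subtype.ext <| funext fun k => by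
    cases k with
    | zero => exact g.2.1.symm
    | succ k => rfl
  right_inv := by
    rintro ⟨⟨d, hd⟩, g, h, hg⟩
    cases h
    rfl

theorem finite_colouring_and_card (w : List Slice) (c : ℕ → α) :
    Finite (Colouring w c) ∧ Nat.card (Colouring w c) = transfer w (fun _ => 1) c := by
  induction w generalizing c with
  | nil => exact ⟨inferInstance, Nat.card_unique⟩
  | cons x w ih =>
    have hfin (d : ℕ → α) : Finite (Colouring w d) := (ih d).1
    have e : Colouring (x :: w) c ≃ Σ t : {t // t ∈ x.kind.tops (window x.pos x.kind.bot c)},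
        Colouring w (splice x.pos x.kind.bot t.1 c) :=
      (colouringCons x w c).trans
        (Equiv.sigmaCongrLeft (β := fun d => Colouring w d.1) (fitsEquiv x c).symm).symm
    refine ⟨Finite.of_equiv _ e.symm, ?_⟩
    rw [Nat.card_congr e, Nat.card_sigma]
    exact (Finset.sum_congr rfl fun t _ => (ih _).2).trans
      (Finset.sum_coe_sort _ fun t => transfer w (fun _ => 1) (splice x.pos x.kind.bot t c))

theorem widthAt_succ {w : List Slice} {k : ℕ} {x : Slice} (h : w[k]? = some x) :
    widthAt w (k + 1) = x.next (widthAt w k) := by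
  rw [widthAt, List.take_add_one, h, List.foldl_append]
  rfl

theorem IsTangle.le_foldl_next {w : List Slice} {n m : ℕ} (hw : IsTangle n w m) {k : ℕ} {x : Slice}
    (h : w[k]? = some x) :
    x.pos + x.kind.bot ≤ (w.take k).foldl (fun n x => x.next n) n := by
  induction w generalizing n k with
  | nil => cases h
  | cons y w ih =>
    cases k with
    | zero => cases h; exact hw.1
    | succ k => exact ih hw.2 h

theorem le_widthAt (L : LinkDiagram) {k : ℕ} {x : Slice} (h : L.1[k]? = some x) :
    x.pos + x.kind.bot ≤ widthAt L.1 k :=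
  L.2.le_foldl_next h

/-- The pairs of numbers that describe a point of the diagram. -/
def pointSet (w : List Slice) : Set (ℕ × ℕ) := {p | p.1 ≤ w.length ∧ p.2 < widthAt w p.1}

theorem finite_pointSet (w : List Slice) : (pointSet w).Finite := by
  refine ((Set.finite_Iic w.length).biUnion fun k _ =>
    (Set.finite_Iio (widthAt w k)).image (Prod.mk k)).subset ?_
  rintro ⟨k, j⟩ ⟨hk, hj⟩
  exact Set.mem_biUnion hk ⟨j, hj, rfl⟩

theorem Joined.mem_pointSet_iff {L : LinkDiagram} {p q : ℕ × ℕ} (h : Joined L.1 p q) :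
    p ∈ pointSet L.1 ↔ q ∈ pointSet L.1 := by
  have hlt {k : ℕ} {x : Slice} (h : L.1[k]? = some x) : k < L.1.length :=
    (List.getElem?_eq_some_iff.1 h).1
  rcases h with ⟨k, x, j, hx, hj⟩ | ⟨k, x, j, hx⟩ | ⟨k, i, hx⟩ | ⟨k, i, hx⟩ | ⟨k, i, s, hx⟩ |
      ⟨k, i, s, hx⟩ <;>
    · have h₁ := hlt hx
      have h₂ := le_widthAt L hx
      simp only [pointSet, Set.mem_ofPred_eq, widthAt_succ hx, Slice.next, LinkDiagram.cup,
        LinkDiagram.cap, cross, Kind.bot, Kind.top] at h₂ ⊢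
      omega

theorem Colouring.eq_default {L : LinkDiagram} (g : Colouring L.1 (default : ℕ → α)) {k j : ℕ}
    (hj : (k, j) ∉ pointSet L.1) : g.1 k j = default := by
  rcases lt_or_ge L.1.length k with hk | hk
  · rw [g.2.2.2 k hk]
    rfl
  induction k generalizing j with
  | zero => rw [g.2.1]; rfl
  | succ k ih =>
    obtain ⟨x, hx⟩ : ∃ x, L.1[k]? = some x := ⟨_, List.getElem?_eq_getElem hk⟩
    have hle := le_widthAt L hx
    simp only [pointSet, Set.mem_ofPred_eq, widthAt_succ hx, Slice.next] at hj ih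
    obtain ⟨j, rfl⟩ : ∃ l, j = x.pos + x.kind.top + l := Nat.exists_eq_add_of_le (by omega)
    rw [← (g.2.2.1 k x hx).2.1]
    exact ih (by omega) (by omega)

/-- The colourings of a diagram are the functions on the set of its components. -/
noncomputable def colouringEquiv (L : LinkDiagram) :
    (Quot (fun p q : Point L.1 => Joined L.1 p.1 q.1) → α) ≃ Colouring L.1 (default : ℕ → α) where
  toFun f := by
    classical
    exact ⟨fun k j => if h : (k, j) ∈ pointSet L.1 then f (Quot.mk _ ⟨(k, j), h⟩) else default, by
      funext j
      exact dif_neg fun h => absurd h.2 (Nat.not_lt_zero j), by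
      rw [forall_fits_iff]
      intro p q h
      by_cases hp : p ∈ pointSet L.1
      · rw [dif_pos hp, dif_pos (h.mem_pointSet_iff.1 hp)]
        exact congrArg f (Quot.sound h)
      · rw [dif_neg hp, dif_neg (mt h.mem_pointSet_iff.2 hp)], by
      intro k hk
      funext j
      exact dif_neg fun h => h.1.not_gt hk⟩
  invFun g := Quot.lift (fun p => g.1 p.1.1 p.1.2) fun p q h =>
    (forall_fits_iff L.1 g.1).1 g.2.2.1 p.1 q.1 h
  left_inv f := by
    funext p
    induction p using Quot.ind with
    | mk p => exact dif_pos p.2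
  right_inv g := by
    refine Subtype.ext (funext fun k => funext fun j => ?_)
    by_cases h : (k, j) ∈ pointSet L.1
    · exact dif_pos h
    · exact (dif_neg h).trans (g.eq_default h).symm

theorem numColourings_eq_card_pow (L : LinkDiagram) :
    numColourings α L = Fintype.card α ^ L.numComponents := by
  have : Finite (Point L.1) := (finite_pointSet L.1).to_subtype
  have : Finite (Quot fun p q : Point L.1 => Joined L.1 p.1 q.1) := Quot.finite _
  rw [numColourings, ← (finite_colouring_and_card L.1 default).2,
    ← Nat.card_congr (colouringEquiv L), Nat.card_fun, numComponents, Nat.card_eq_fintype_card]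

end Colourings

theorem numComponents_eq_of_moveEquiv {N : ℕ} (hN : Even N) {L L' : LinkDiagram}
    (h : MoveEquiv N L L') : L.numComponents = L'.numComponents := by
  have := numColourings_eq_of_moveEquiv (α := Bool) hN h
  rw [numColourings_eq_card_pow, numColourings_eq_card_pow] at this
  exact Nat.pow_right_injective le_rfl this

theorem numComponents_eq_of_numColourings_eq {L : LinkDiagram} {n : ℕ}
    (h : numColourings Bool L = 2 ^ n) : L.numComponents = n :=
  Nat.pow_right_injective le_rfl ((numColourings_eq_card_pow L).symm.trans h)

/-! ### Equivalence of tangles -/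

theorem isTangle_nil {n m : ℕ} : IsTangle n [] m ↔ n = m := Iff.rfl

theorem isTangle_cup_cons {n m i : ℕ} {w : List Slice} :
    IsTangle n (cup i :: w) m ↔ i ≤ n ∧ IsTangle (n + 2) w m :=
  Iff.rfl

theorem isTangle_cap_cons {n m i : ℕ} {w : List Slice} :
    IsTangle n (cap i :: w) m ↔ i + 2 ≤ n ∧ IsTangle (n - 2) w m :=
  Iff.rfl

theorem isTangle_cross_cons {n m i : ℕ} {s : Bool} {w : List Slice} :
    IsTangle n (cross s i :: w) m ↔ i + 2 ≤ n ∧ IsTangle n w m :=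
  and_congr_right fun h => by
    rw [show (cross s i).next n = n from Nat.sub_add_cancel (Nat.le_of_add_left_le h)]

theorem ReidemeisterMove.isTangle {a b : List Slice} (h : ReidemeisterMove a b) {n m : ℕ}
    (ha : IsTangle n a m) : IsTangle n b m := by
  cases h with
  | commute x y i k => simp only [IsTangle, Slice.next] at ha ⊢; omega
  | _ =>
    simp only [isTangle_nil, isTangle_cup_cons, isTangle_cap_cons, isTangle_cross_cons] at ha ⊢
    omega

theorem isTangle_append {n m : ℕ} {u v : List Slice} :
    IsTangle n (u ++ v) m ↔ ∃ k, IsTangle n u k ∧ IsTangle k v m := by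
  refine ⟨fun h => ?_, fun ⟨k, hu, hv⟩ => hu.append hv⟩
  induction u generalizing n with
  | nil => exact ⟨n, rfl, h⟩
  | cons x u ih =>
    obtain ⟨k, hu, hv⟩ := ih h.2
    exact ⟨k, ⟨h.1, hu⟩, hv⟩

/-- The equivalence relation on the words of slices that represent tangles with `n` lower and `m`
upper ends which is generated by the local moves `R`; any other word is equivalent to itself
only. -/
def TangleEquiv (R : List Slice → List Slice → Prop) (n m : ℕ) : List Slice → List Slice → Prop :=
  Relation.EqvGen fun w w' => IsTangle n w m ∧ IsTangle n w' m ∧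
    ∃ u a b v, R a b ∧ w = u ++ a ++ v ∧ w' = u ++ b ++ v

/-- The local form of the isotopies and `N`-moves. -/
def LocalMove (N : ℕ) (a b : List Slice) : Prop := ReidemeisterMove a b ∨ TwistMove N a b

local notation "σ" => cross true

local notation "σ⁻" => cross false

local notation:50 w "≈[" n "," m "]" w' => TangleEquiv ReidemeisterMove n m w w'

namespace TangleEquiv

variable {R : List Slice → List Slice → Prop} {n m : ℕ} {w w' w'' : List Slice}

theorem refl (R : List Slice → List Slice → Prop) (n m : ℕ) (w : List Slice) :
    TangleEquiv R n m w w :=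
  Relation.EqvGen.refl w

theorem symm (h : TangleEquiv R n m w w') : TangleEquiv R n m w' w := Relation.EqvGen.symm _ _ h

theorem trans (h : TangleEquiv R n m w w') (h' : TangleEquiv R n m w' w'') :
    TangleEquiv R n m w w'' :=
  Relation.EqvGen.trans _ _ _ h h'

instance : Trans (TangleEquiv R n m) (TangleEquiv R n m) (TangleEquiv R n m) := ⟨trans⟩

theorem isTangle_iff (h : TangleEquiv R n m w w') : IsTangle n w m ↔ IsTangle n w' m := by
  induction h with
  | rel _ _ h => exact iff_of_true h.1 h.2.1
  | refl => rfl
  | symm _ _ _ ih => exact ih.symm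
  | trans _ _ _ _ _ ih₁ ih₂ => exact ih₁.trans ih₂

theorem mono {R' : List Slice → List Slice → Prop} (hR : ∀ a b, R a b → R' a b)
    (h : TangleEquiv R n m w w') : TangleEquiv R' n m w w' :=
  Relation.EqvGen.mono
    (fun _ _ ⟨hw, hw', u, a, b, v, h, e⟩ => ⟨hw, hw', u, a, b, v, hR a b h, e⟩) _ _ h

theorem localMove (h : TangleEquiv ReidemeisterMove n m w w') (N : ℕ) :
    TangleEquiv (LocalMove N) n m w w' :=
  h.mono fun _ _ => .inl

theorem context (h : TangleEquiv R n m w w') {k l : ℕ} {u v : List Slice} (hu : IsTangle k u n)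
    (hv : IsTangle m v l) : TangleEquiv R k l (u ++ w ++ v) (u ++ w' ++ v) := by
  induction h with
  | rel w w' h =>
    obtain ⟨hw, hw', u', a, b, v', h, rfl, rfl⟩ := h
    exact .rel _ _ ⟨(hu.append hw).append hv, (hu.append hw').append hv,
      u ++ u', a, b, v' ++ v, h, by simp, by simp⟩
  | refl => exact refl ..
  | symm _ _ _ ih => exact ih.symm
  | trans _ _ _ _ _ ih₁ ih₂ => exact ih₁.trans ih₂

theorem append_left (h : TangleEquiv R n m w w') {k : ℕ} {u : List Slice} (hu : IsTangle k u n) :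
    TangleEquiv R k m (u ++ w) (u ++ w') := by
  simpa only [List.append_nil] using h.context hu (v := []) rfl

theorem append_right (h : TangleEquiv R n m w w') {l : ℕ} {v : List Slice} (hv : IsTangle m v l) :
    TangleEquiv R n l (w ++ v) (w' ++ v) :=
  h.context (u := []) rfl hv

theorem step (h : TangleEquiv R 0 0 w w') (hw : IsTangle 0 w 0) (hw' : IsTangle 0 w' 0) :
    Relation.EqvGen (Step R) ⟨w, hw⟩ ⟨w', hw'⟩ := by
  induction h with
  | rel w w' h => exact .rel _ _ h.2.2
  | refl => exact .refl _
  | symm _ _ _ ih => exact .symm _ _ (ih _ _)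
  | trans _ _ _ h _ ih₁ ih₂ => exact .trans _ _ _ (ih₁ _ ((isTangle_iff h).1 hw)) (ih₂ _ _)

theorem moveEquiv {N : ℕ} (h : TangleEquiv (LocalMove N) 0 0 w w') (hw : IsTangle 0 w 0)
    (hw' : IsTangle 0 w' 0) : MoveEquiv N ⟨w, hw⟩ ⟨w', hw'⟩ :=
  Relation.EqvGen.mono (r := Step (LocalMove N)) (fun _ _ ⟨u, a, b, v, hab, e⟩ =>
    hab.imp (fun hab => ⟨u, a, b, v, hab, e⟩) fun hab => ⟨u, a, b, v, hab, e⟩) _ _ (h.step hw hw')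

theorem of_reidemeisterMove {a b : List Slice} (r : ReidemeisterMove a b) (h : IsTangle n a m) :
    a ≈[n, m] b :=
  .rel _ _ ⟨h, r.isTangle h, [], a, b, [], r, by simp, by simp⟩

theorem replace (k : ℕ) {p q : ℕ} {a b : List Slice} (r : TangleEquiv R p q a b)
    (hw : w = w.take k ++ a ++ w.drop (k + a.length) := by rfl)
    (hw' : w' = w.take k ++ b ++ w.drop (k + a.length) := by rfl)
    (hu : decide (IsTangle n (w.take k) p) = true := by rfl)
    (hv : decide (IsTangle q (w.drop (k + a.length)) m) = true := by rfl) :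
    TangleEquiv R n m w w' := by
  have := r.context (of_decide_eq_true hu) (of_decide_eq_true hv)
  rwa [← hw, ← hw'] at this

theorem move (k : ℕ) {a b : List Slice} (r : ReidemeisterMove a b)
    (hw : w = w.take k ++ a ++ w.drop (k + a.length) := by rfl)
    (hw' : w' = w.take k ++ b ++ w.drop (k + a.length) := by rfl)
    (h : IsTangle n w m := by
      simp only [isTangle_nil, isTangle_cup_cons, isTangle_cap_cons, isTangle_cross_cons,
        and_true] <;> omega) :
    w ≈[n, m] w' := by
  have h' := h
  rw [hw, isTangle_append] at h'
  obtain ⟨q, h₁, hv⟩ := h'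
  obtain ⟨p, hu, ha⟩ := isTangle_append.1 h₁
  have := (of_reidemeisterMove r ha).context hu hv
  rwa [← hw, ← hw'] at this

theorem move_symm (k : ℕ) {a b : List Slice} (r : ReidemeisterMove a b)
    (hw : w = w.take k ++ b ++ w.drop (k + b.length) := by rfl)
    (hw' : w' = w.take k ++ a ++ w.drop (k + b.length) := by rfl)
    (h : IsTangle n w' m := by
      simp only [isTangle_nil, isTangle_cup_cons, isTangle_cap_cons, isTangle_cross_cons,
        and_true] <;> omega) :
    w ≈[n, m] w' := by
  have h' := h
  rw [hw', isTangle_append] at h'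
  obtain ⟨q, h₁, hv⟩ := h'
  obtain ⟨p, hu, ha⟩ := isTangle_append.1 h₁
  have := ((of_reidemeisterMove r ha).context hu hv).symm
  rwa [← hw, ← hw'] at this

end TangleEquiv

open TangleEquiv ReidemeisterMove

theorem circle_shift {n i : ℕ} (h : i + 1 ≤ n) :
    [cup i, cap i] ≈[n, n] [cup (i + 1), cap (i + 1)] :=
  calc
    [cup i, cap i] ≈[n, n] [cup i, σ (i + 1), σ⁻ (i + 1), cap i] :=
      move_symm 1 (r2 true (i + 1))
    _ ≈[n, n] [cup (i + 1), σ⁻ i, σ⁻ (i + 1), cap i] := move 0 (slideCup true i)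
    _ ≈[n, n] [cup (i + 1), σ⁻ i, σ i, cap (i + 1)] := move 2 (slideCap false i)
    _ ≈[n, n] [cup (i + 1), cap (i + 1)] := move 1 (r2 false i)

theorem cup_cross_cross {n i : ℕ} (h : i + 2 ≤ n) (s : Bool) :
    [cup i, cross s (i + 1), cross s (i + 2)] ≈[n, n + 2]
      [cup (i + 2), cross (!s) (i + 1), cross (!s) i] :=
  calc
    [cup i, cross s (i + 1), cross s (i + 2)]
    _ ≈[n, n + 2] [cup (i + 1), cross (!s) i, cross s (i + 2)] := move 0 (slideCup s i)
    _ ≈[n, n + 2] [cup (i + 1), cross s (i + 2), cross (!s) i] := move 1 (commute _ _ i 0)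
    _ ≈[n, n + 2] [cup (i + 2), cross (!s) (i + 1), cross (!s) i] := move 0 (slideCup s (i + 1))

theorem cross_cross_cross {n i : ℕ} (h : i + 3 ≤ n) :
    [σ⁻ i, σ⁻ (i + 1), σ i] ≈[n, n] [σ (i + 1), σ⁻ i, σ⁻ (i + 1)] :=
  calc
    [σ⁻ i, σ⁻ (i + 1), σ i]
    _ ≈[n, n] [σ (i + 1), σ⁻ (i + 1), σ⁻ i, σ⁻ (i + 1), σ i] := move_symm 0 (r2 true (i + 1))
    _ ≈[n, n] [σ (i + 1), σ⁻ i, σ⁻ (i + 1), σ⁻ i, σ i] := move_symm 1 (r3 false i)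
    _ ≈[n, n] [σ (i + 1), σ⁻ i, σ⁻ (i + 1)] := move 3 (r2 false i)

-- The first Reidemeister move adds a crossing to the circle on the left of the strands `0` and `1`;
-- this crossing travels over to their right, where another first Reidemeister move removes it.
theorem circle_flip :
    [cup 2, σ 1, σ 0, σ 0, σ 1, cap 2] ≈[4, 4] [cup 2, σ⁻ 1, σ⁻ 0, σ⁻ 0, σ⁻ 1, cap 2] :=
  calc
    [cup 2, σ 1, σ 0, σ 0, σ 1, cap 2]
    _ ≈[4, 4] [cup 0, σ⁻ 1, σ⁻ 2, σ 0, σ 1, cap 2] :=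
      .replace 0 (cup_cross_cross (n := 4) (i := 0) (by omega) false).symm
    _ ≈[4, 4] [cup 0, σ⁻ 0, σ⁻ 1, σ⁻ 2, σ 0, σ 1, cap 2] := move_symm 0 (r1Cup false 0)
    _ ≈[4, 4] [cup 0, σ⁻ 0, σ⁻ 1, σ 0, σ⁻ 2, σ 1, cap 2] :=
      move_symm 3 (commute (.cross true) _ 0 0)
    _ ≈[4, 4] [cup 0, σ 1, σ⁻ 0, σ⁻ 1, σ⁻ 2, σ 1, cap 2] :=
      .replace 1 (cross_cross_cross (n := 6) (i := 0) (by omega))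
    _ ≈[4, 4] [cup 0, σ 1, σ⁻ 0, σ 2, σ⁻ 1, σ⁻ 2, cap 2] :=
      .replace 3 (cross_cross_cross (n := 6) (i := 1) (by omega))
    _ ≈[4, 4] [cup 0, σ 1, σ⁻ 0, σ 2, σ⁻ 1, cap 2] := move 5 (r1Cap false 2)
    _ ≈[4, 4] [cup 0, σ 1, σ 2, σ⁻ 0, σ⁻ 1, cap 2] := move 2 (commute _ _ 0 0)
    _ ≈[4, 4] [cup 2, σ⁻ 1, σ⁻ 0, σ⁻ 0, σ⁻ 1, cap 2] :=
      .replace 0 (cup_cross_cross (n := 4) (i := 0) (by omega) true)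

theorem circle_conjugate :
    [cup 2, σ 1, σ 0, σ 0, σ⁻ 1, cap 2] ≈[4, 4] [cup 1, σ 0, σ 0, cap 1] :=
  calc
    [cup 2, σ 1, σ 0, σ 0, σ⁻ 1, cap 2]
    _ ≈[4, 4] [cup 1, σ⁻ 2, σ 0, σ 0, σ⁻ 1, cap 2] := move_symm 0 (slideCup false 1)
    _ ≈[4, 4] [cup 1, σ⁻ 2, σ 0, σ 0, σ 2, cap 1] := move_symm 4 (slideCap true 1)
    _ ≈[4, 4] [cup 1, σ 0, σ⁻ 2, σ 0, σ 2, cap 1] := move_symm 1 (commute (.cross true) _ 0 0)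
    _ ≈[4, 4] [cup 1, σ 0, σ 0, σ⁻ 2, σ 2, cap 1] := move_symm 2 (commute (.cross true) _ 0 0)
    _ ≈[4, 4] [cup 1, σ 0, σ 0, cap 1] := move 3 (r2 false 2)

theorem closureWord_hopfLink_circle :
    [cup 0, cup 1, σ 0, σ 0, cup 1, σ 0, σ 0, cap 1, cap 1, cap 0] ≈[0, 0] hopfSum.1 :=
  calc
    [cup 0, cup 1, σ 0, σ 0, cup 1, σ 0, σ 0, cap 1, cap 1, cap 0]
    _ ≈[0, 0] [cup 0, cup 1, σ 0, σ 0, cup 1, σ 0, σ 0, cap 3, cap 1, cap 0] :=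
      move 7 (commute _ _ 1 0)
    _ ≈[0, 0] [cup 0, cup 1, σ 0, σ 0, cup 1, σ 0, cap 3, σ 0, cap 1, cap 0] :=
      move 6 (commute _ _ 0 1)
    _ ≈[0, 0] [cup 0, cup 1, σ 0, σ 0, cup 1, cap 3, σ 0, σ 0, cap 1, cap 0] :=
      move 5 (commute _ _ 0 1)
    _ ≈[0, 0] [cup 0, cup 1, σ 0, σ 0, cap 1, cup 1, σ 0, σ 0, cap 1, cap 0] :=
      move 4 (commute _ _ 1 0)

theorem slide_cross_cup_cap (s t u : Bool) :
    [cup 1, cross s 2, cross t 0, cross u 4, cross s 2, cap 1] ≈[4, 4]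
      [cup 2, cross (!s) 1, cross t 0, cross (!s) 1, cross u 4, cap 2] :=
  calc
    [cup 1, cross s 2, cross t 0, cross u 4, cross s 2, cap 1]
    _ ≈[4, 4] [cup 2, cross (!s) 1, cross t 0, cross u 4, cross s 2, cap 1] := move 0 (slideCup s 1)
    _ ≈[4, 4] [cup 2, cross (!s) 1, cross t 0, cross u 4, cross (!s) 1, cap 2] :=
      move 4 (slideCap s 1)
    _ ≈[4, 4] [cup 2, cross (!s) 1, cross t 0, cross (!s) 1, cross u 4, cap 2] :=
      move_symm 3 (commute (.cross (!s)) _ 1 1)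

theorem replicate_cross (N : ℕ) {n i : ℕ} (h : i + 2 ≤ n) (s : Bool) :
    TangleEquiv (LocalMove N) n n [] (List.replicate N (cross s i)) := by
  refine .rel _ _ ⟨rfl, ?_, [], [], _, [], .inr (.twist s i), rfl, by simp⟩
  induction N with
  | zero => rfl
  | succ N ih => exact isTangle_cross_cons.2 ⟨h, ih⟩

theorem cross_cross_flip {n i : ℕ} (h : i + 2 ≤ n) :
    TangleEquiv (LocalMove 4) n n [σ i, σ i] [σ⁻ i, σ⁻ i] :=
  calc
    TangleEquiv (LocalMove 4) n n [σ i, σ i] [σ⁻ i, σ⁻ i, σ⁻ i, σ⁻ i, σ i, σ i] :=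
      (replicate_cross 4 h false).append_right (v := [σ i, σ i])
        (by simp only [isTangle_cross_cons, isTangle_nil, h, and_true])
    TangleEquiv (LocalMove 4) n n _ [σ⁻ i, σ⁻ i, σ⁻ i, σ i] := (move 3 (r2 false i)).localMove 4
    TangleEquiv (LocalMove 4) n n _ [σ⁻ i, σ⁻ i] := (move 2 (r2 false i)).localMove 4

theorem ReidemeisterMove.slideCup_not (s : Bool) (i : ℕ) :
    ReidemeisterMove [cup i, cross (!s) (i + 1)] [cup (i + 1), cross s i] := by
  simpa only [Bool.not_not] using slideCup (!s) i

theorem ReidemeisterMove.slideCap_not (s : Bool) (i : ℕ) :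
    ReidemeisterMove [cross (!s) (i + 1), cap i] [cross s i, cap (i + 1)] := by
  simpa only [Bool.not_not] using slideCap (!s) i

/-- The `n` nested minima below a closed braid. -/
def cups (n : ℕ) : List Slice := (List.range n).map cup

/-- The `n` nested maxima above a closed braid. -/
def caps (n : ℕ) : List Slice := (List.range n).reverse.map cap

/-- The word of slices of a braid. -/
def braidSlices {n : ℕ} (β : BraidWord n) : List Slice := β.map fun g => cross g.2 g.1

theorem isTangle_zero_cups (n : ℕ) : IsTangle 0 (cups n) (2 * n) := isTangle_cups n

theorem isTangle_caps_zero (n : ℕ) : IsTangle (2 * n) (caps n) 0 := isTangle_caps n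

theorem cups_succ (n : ℕ) : cups (n + 1) = cups n ++ [cup n] := by
  rw [cups, List.range_succ, List.map_append]
  rfl

theorem caps_succ (n : ℕ) : caps (n + 1) = cap n :: caps n := by
  rw [caps, List.range_succ, List.reverse_append]
  rfl

theorem braidSlices_append {n : ℕ} (β γ : BraidWord n) :
    braidSlices (β ++ γ) = braidSlices β ++ braidSlices γ :=
  List.map_append

theorem closureWord_eq (n : ℕ) (β : BraidWord n) :
    closureWord n β = cups n ++ braidSlices β ++ caps n :=
  rfl

theorem isTangle_braidSlices {n m : ℕ} (h : n ≤ m) (β : BraidWord n) :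
    IsTangle m (braidSlices β) m := by
  induction β with
  | nil => rfl
  | cons g β ih =>
    have := g.1.2
    exact isTangle_cross_cons.2 ⟨by omega, ih⟩

theorem cross_comm (s t : Bool) {m i j : ℕ} (hij : i + 2 ≤ j) (hj : j + 2 ≤ m) :
    [cross s i, cross t j] ≈[m, m] [cross t j, cross s i] := by
  obtain ⟨k, rfl⟩ := Nat.exists_eq_add_of_le hij
  exact move 0 (commute _ _ i k)

theorem cross_cap_comm (s : Bool) {m i j : ℕ} (hij : i + 2 ≤ j) (hj : j ≤ m) :
    [cross s i, cap j] ≈[m + 2, m] [cap j, cross s i] := by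
  obtain ⟨k, rfl⟩ := Nat.exists_eq_add_of_le hij
  exact move 0 (commute _ _ i k)

theorem cap_cross_comm (s : Bool) {m i j : ℕ} (hij : i ≤ j) (hj : j + 2 ≤ m) :
    [cap i, cross s j] ≈[m + 2, m] [cross s (j + 2), cap i] := by
  obtain ⟨k, rfl⟩ := Nat.exists_eq_add_of_le hij
  rw [Nat.add_right_comm]
  exact move 0 (commute _ _ i k)

theorem cup_cross_comm (s : Bool) {m i j : ℕ} (hij : i + 2 ≤ j) (hj : j ≤ m) :
    [cup j, cross s i] ≈[m, m + 2] [cross s i, cup j] := by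
  obtain ⟨k, rfl⟩ := Nat.exists_eq_add_of_le hij
  exact move_symm 0 (commute (.cross s) _ i k)

theorem cross_cup_comm (s : Bool) {m i j : ℕ} (hij : i ≤ j) (hj : j + 2 ≤ m) :
    [cross s j, cup i] ≈[m, m + 2] [cup i, cross s (j + 2)] := by
  obtain ⟨k, rfl⟩ := Nat.exists_eq_add_of_le hij
  rw [Nat.add_right_comm]
  exact move_symm 0 (commute .cup _ i k)

theorem cross_cap_cap (s : Bool) {m i : ℕ} (h : i ≤ m) :
    [cross s i, cap (i + 1), cap i] ≈[m + 4, m] [cross s (i + 2), cap (i + 1), cap i] :=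
  calc
    [cross s i, cap (i + 1), cap i]
    _ ≈[m + 4, m] [cross (!s) (i + 1), cap i, cap i] := move_symm 0 (slideCap_not s i)
    _ ≈[m + 4, m] [cross (!s) (i + 1), cap (i + 2), cap i] := move 1 (commute _ _ i 0)
    _ ≈[m + 4, m] [cross s (i + 2), cap (i + 1), cap i] := move_symm 0 (slideCap s (i + 1))

theorem cup_cup_cross (s : Bool) {m i : ℕ} (h : i ≤ m) :
    [cup i, cup (i + 1), cross s i] ≈[m, m + 4] [cup i, cup (i + 1), cross s (i + 2)] :=
  calc
    [cup i, cup (i + 1), cross s i]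
    _ ≈[m, m + 4] [cup i, cup i, cross (!s) (i + 1)] := move_symm 1 (slideCup_not s i)
    _ ≈[m, m + 4] [cup i, cup (i + 2), cross (!s) (i + 1)] := move_symm 0 (commute .cup _ i 0)
    _ ≈[m, m + 4] [cup i, cup (i + 1), cross s (i + 2)] := move_symm 1 (slideCup s (i + 1))

theorem cross_caps (s : Bool) {n i j : ℕ} (hi : i + 2 ≤ n) (hij : i + j + 2 = 2 * n) :
    cross s i :: caps n ≈[2 * n, 0] cross s j :: caps n := by
  induction n generalizing j with
  | zero => omega
  | succ n ih =>
    rw [caps_succ]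
    rcases Nat.lt_or_ge n (i + 2) with h | h
    · obtain rfl : n = i + 1 := by omega
      obtain rfl : j = i + 2 := by omega
      rw [caps_succ]
      exact (cross_cap_cap s (m := 2 * i) (by omega)).append_right (isTangle_caps_zero i)
    · obtain ⟨j, rfl⟩ : ∃ k, j = k + 2 := ⟨j - 2, by omega⟩
      have hcap : IsTangle (2 * n + 2) [cap n] (2 * n) :=
        isTangle_cap_cons.2 ⟨by omega, rfl⟩
      calc
        cross s i :: cap n :: caps n
        _ ≈[2 * n + 2, 0] cap n :: cross s i :: caps n :=
          (cross_cap_comm s h (by omega)).append_right (isTangle_caps_zero n)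
        _ ≈[2 * n + 2, 0] cap n :: cross s j :: caps n := (ih h (by omega)).append_left hcap
        _ ≈[2 * n + 2, 0] cross s (j + 2) :: cap n :: caps n :=
          (cap_cross_comm s (by omega) (by omega)).append_right (isTangle_caps_zero n)

theorem cups_cross (s : Bool) {n i j : ℕ} (hi : i + 2 ≤ n) (hij : i + j + 2 = 2 * n) :
    cups n ++ [cross s i] ≈[0, 2 * n] cups n ++ [cross s j] := by
  induction n generalizing j with
  | zero => omega
  | succ n ih =>
    rw [cups_succ]
    simp only [List.append_assoc, List.cons_append, List.nil_append]
    rcases Nat.lt_or_ge n (i + 2) with h | h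
    · obtain rfl : n = i + 1 := by omega
      obtain rfl : j = i + 2 := by omega
      rw [cups_succ]
      simp only [List.append_assoc, List.cons_append, List.nil_append]
      exact (cup_cup_cross s (m := 2 * i) (by omega)).append_left (isTangle_zero_cups i)
    · obtain ⟨j, rfl⟩ : ∃ k, j = k + 2 := ⟨j - 2, by omega⟩
      have hcup : IsTangle (2 * n) [cup n] (2 * n + 2) :=
        isTangle_cup_cons.2 ⟨by omega, rfl⟩
      have := (ih h (j := j) (by omega)).append_right hcup
      simp only [List.append_assoc, List.cons_append, List.nil_append] at this
      calc
        cups n ++ [cup n, cross s i]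
        _ ≈[0, 2 * n + 2] cups n ++ [cross s i, cup n] :=
          (cup_cross_comm s h (by omega)).append_left (isTangle_zero_cups n)
        _ ≈[0, 2 * n + 2] cups n ++ [cross s j, cup n] := this
        _ ≈[0, 2 * n + 2] cups n ++ [cup n, cross s (j + 2)] :=
          (cross_cup_comm s (by omega) (by omega)).append_left (isTangle_zero_cups n)

/-! ### Closed braids -/

theorem braidSlices_cross_comm {n m j : ℕ} (hj : n ≤ j) (hm : j + 2 ≤ m) (s : Bool)
    (β : BraidWord n) :
    braidSlices β ++ [cross s j] ≈[m, m] cross s j :: braidSlices β := by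
  induction β with
  | nil => exact refl ..
  | cons g β ih =>
    have := g.1.2
    have hg : IsTangle m [cross g.2 g.1] m := isTangle_cross_cons.2 ⟨by omega, rfl⟩
    exact (ih.append_left hg).trans ((cross_comm g.2 s (by omega) hm).append_right
      (isTangle_braidSlices (by omega) β))

theorem braidSlices_cup_comm {n m : ℕ} (hm : n ≤ m) (β : BraidWord n) :
    cup n :: braidSlices β ≈[m, m + 2] braidSlices β ++ [cup n] := by
  induction β with
  | nil => exact refl ..
  | cons g β ih =>
    have := g.1.2
    have hg : IsTangle m [cross g.2 g.1] m := isTangle_cross_cons.2 ⟨by omega, rfl⟩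
    exact ((cup_cross_comm g.2 (by omega) hm).append_right
      (isTangle_braidSlices (by omega) β)).trans (ih.append_left hg)

theorem closureWord_cons {n : ℕ} (g : Fin (n - 1) × Bool) (β : BraidWord n) :
    closureWord n (g :: β) ≈[0, 0] closureWord n (β ++ [g]) := by
  obtain ⟨⟨i, hi⟩, s⟩ := g
  obtain ⟨j, hij⟩ : ∃ j, i + j + 2 = 2 * n := ⟨2 * n - i - 2, by omega⟩
  have hβ : IsTangle (2 * n) (braidSlices β) (2 * n) := isTangle_braidSlices (by omega) β
  rw [closureWord_eq, closureWord_eq, braidSlices_append]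
  calc
    cups n ++ (cross s i :: braidSlices β) ++ caps n
    _ ≈[0, 0] cups n ++ (cross s j :: braidSlices β) ++ caps n := by
      simpa using
        (cups_cross s (by omega) hij).append_right (hβ.append (isTangle_caps_zero n))
    _ ≈[0, 0] cups n ++ (braidSlices β ++ [cross s j]) ++ caps n :=
      (braidSlices_cross_comm (by omega) (by omega) s β).symm.context (isTangle_zero_cups n)
        (isTangle_caps_zero n)
    _ ≈[0, 0] cups n ++ (braidSlices β ++ [cross s i]) ++ caps n := by
      simpa using
        (cross_caps s (by omega) hij).symm.append_left ((isTangle_zero_cups n).append hβ)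

theorem closureWord_append_comm {n : ℕ} (β γ : BraidWord n) :
    closureWord n (β ++ γ) ≈[0, 0] closureWord n (γ ++ β) := by
  induction β generalizing γ with
  | nil => rw [List.nil_append, List.append_nil]; exact refl ..
  | cons g β ih =>
    calc
      closureWord n (g :: (β ++ γ))
      _ ≈[0, 0] closureWord n (β ++ (γ ++ [g])) := by
        simpa using closureWord_cons g (β ++ γ)
      _ ≈[0, 0] closureWord n (γ ++ g :: β) := by
        simpa using ih (γ ++ [g])

/-- The braid with one more strand on the right, which crosses no other strand. -/
def addStrand {n : ℕ} (β : BraidWord n) : BraidWord (n + 1) :=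
  β.map (Prod.map (Fin.castLE (Nat.sub_le_sub_right n.le_succ 1)) id)

theorem braidSlices_addStrand {n : ℕ} (β : BraidWord n) :
    braidSlices (addStrand β) = braidSlices β := by
  simp only [braidSlices, addStrand, List.map_map]
  rfl

theorem closureWord_addStrand_append {n : ℕ} (β : BraidWord n) (γ : BraidWord (n + 1))
    {W : List Slice} (h : TangleEquiv ReidemeisterMove (2 * n) (2 * n)
      (cup n :: (braidSlices γ ++ [cap n])) W) :
    closureWord (n + 1) (addStrand β ++ γ) ≈[0, 0] cups n ++ braidSlices β ++ W ++ caps n := by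
  have hγ : IsTangle (2 * n + 2) (braidSlices γ ++ caps (n + 1)) 0 :=
    (isTangle_braidSlices (by omega) γ).append (isTangle_caps_zero (n + 1))
  rw [closureWord_eq, braidSlices_append, braidSlices_addStrand, cups_succ]
  calc
    cups n ++ [cup n] ++ (braidSlices β ++ braidSlices γ) ++ caps (n + 1)
    _ ≈[0, 0] cups n ++ (braidSlices β ++ [cup n]) ++ (braidSlices γ ++ caps (n + 1)) := by
      simpa using
        (braidSlices_cup_comm (by omega) β).context (isTangle_zero_cups n) hγ
    _ ≈[0, 0] cups n ++ braidSlices β ++ W ++ caps n := by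
      simpa [caps_succ] using
        h.context ((isTangle_zero_cups n).append (isTangle_braidSlices (by omega) β))
          (isTangle_caps_zero n)

theorem cup_cross_cap (s : Bool) {m i : ℕ} (h : i + 1 ≤ m) :
    [cup (i + 1), cross s i, cap (i + 1)] ≈[m, m] [] :=
  calc
    [cup (i + 1), cross s i, cap (i + 1)]
    _ ≈[m, m] [cup i, cross (!s) (i + 1), cap (i + 1)] := move_symm 0 (slideCup_not s i)
    _ ≈[m, m] [cup i, cap (i + 1)] := move 1 (r1Cap (!s) (i + 1))
    _ ≈[m, m] [] := move 0 (zigzagLeft i)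

theorem closureWord_stabilization {n : ℕ} (β : BraidWord (n + 1)) (s : Bool) :
    closureWord (n + 2) (addStrand β ++ ([(Fin.last n, s)] : BraidWord (n + 2))) ≈[0, 0]
      closureWord (n + 1) β := by
  simpa only [List.append_nil, closureWord_eq (n + 1)] using
    closureWord_addStrand_append β [(Fin.last n, s)] (cup_cross_cap s (by omega))

theorem circle_shift_right {n : ℕ} {i j : ℕ} (hij : i ≤ j) (hj : j ≤ n) :
    [cup i, cap i] ≈[n, n] [cup j, cap j] := by
  induction j, hij using Nat.le_induction with
  | base => exact refl ..
  | succ j _ ih => exact (ih (by omega)).trans (circle_shift hj)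

theorem slice_circle_comm (x : Slice) {n : ℕ} (h : x.pos + x.kind.bot ≤ n) :
    [cup n, cap n, x] ≈[n, x.next n] [x, cup (x.next n), cap (x.next n)] := by
  obtain ⟨x, i⟩ := x
  obtain ⟨k, rfl⟩ := Nat.exists_eq_add_of_le h
  have hn : (⟨x, i⟩ : Slice).next (i + x.bot + k) = i + x.top + k := by
    simp only [Slice.next]; omega
  have htangle : IsTangle (i + x.bot + k) [⟨x, i⟩, cup (i + x.top + k), cap (i + x.top + k)]
      (i + x.top + k) :=
    ⟨h, hn ▸ isTangle_cup_cons.2 ⟨le_rfl, isTangle_cap_cons.2 ⟨le_rfl, rfl⟩⟩⟩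
  have hcup : [cup (i + x.bot + k), ⟨x, i⟩, cap (i + x.top + k)] ≈[i + x.bot + k, i + x.top + k]
      [⟨x, i⟩, cup (i + x.top + k), cap (i + x.top + k)] :=
    move_symm 0 (commute x .cup i k) (h := htangle)
  rw [hn]
  exact (move_symm 1 (commute x .cap i k) (h := hcup.isTangle_iff.2 htangle)).trans hcup

theorem circle_comm {n m : ℕ} {w : List Slice} (hw : IsTangle n w m) :
    [cup n, cap n] ++ w ≈[n, m] w ++ [cup m, cap m] := by
  induction w generalizing n with
  | nil => cases hw; exact refl ..
  | cons x w ih =>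
    exact ((slice_circle_comm x hw.1).append_right hw.2).trans
      ((ih hw.2).append_left (u := [x]) ⟨hw.1, rfl⟩)

theorem closureWord_addStrand {n : ℕ} (β : BraidWord n) :
    closureWord (n + 1) (addStrand β) ≈[0, 0] closureWord n β ++ unknot.1 := by
  have hβ : IsTangle 0 (cups n ++ braidSlices β) (2 * n) :=
    (isTangle_zero_cups n).append (isTangle_braidSlices (by omega) β)
  have hcirc : [cup n, cap n] ++ caps n ≈[2 * n, 0] caps n ++ unknot.1 :=
    ((circle_shift_right (by omega) le_rfl).append_right (isTangle_caps_zero n)).trans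
      (circle_comm (isTangle_caps_zero n))
  have h := closureWord_addStrand_append β [] (W := [cup n, cap n]) (refl ..)
  rw [List.append_nil] at h
  calc
    closureWord (n + 1) (addStrand β)
    _ ≈[0, 0] cups n ++ braidSlices β ++ ([cup n, cap n] ++ caps n) := by
      rwa [List.append_assoc] at h
    _ ≈[0, 0] closureWord n β ++ unknot.1 := by
      simpa only [closureWord_eq, List.append_assoc] using hcirc.append_left hβ

theorem closureWord_nil (n : ℕ) : closureWord n [] ≈[0, 0] (trivialLink n).1 := by
  induction n with
  | zero => exact refl ..
  | succ n ih => exact (closureWord_addStrand []).trans (ih.append_right unknot.2)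

theorem closureWord_flip (β : BraidWord 2) :
    closureWord 3 (addStrand β ++ [(1, true), (0, true), (0, true), (1, true)]) ≈[0, 0]
      closureWord 3 (addStrand β ++ [(1, false), (0, false), (0, false), (1, false)]) :=
  (closureWord_addStrand_append β [(1, true), (0, true), (0, true), (1, true)] circle_flip).trans
    (closureWord_addStrand_append β [(1, false), (0, false), (0, false), (1, false)] (refl ..)).symm

theorem closureWord_hopfSum :
    closureWord 3 [(0, true), (0, true), (1, true), (0, true), (0, true), (1, false)] ≈[0, 0]
      hopfSum.1 :=
  (closureWord_addStrand_append [(0, true), (0, true)]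
    [(1, true), (0, true), (0, true), (1, false)] circle_conjugate).trans
    closureWord_hopfLink_circle

theorem circle_crosses_flip (t u : Bool) :
    TangleEquiv (LocalMove 4) 4 4 [cup 2, σ⁻ 1, cross t 0, σ⁻ 1, cross u 4, cap 2]
      [cup 2, σ 1, cross t 0, σ 1, cross u 4, cap 2] := by
  have hgather (s : Bool) : [cup 1, cross s 2, cross t 0, cross u 4, cross s 2, cap 1] ≈[4, 4]
      [cup 1, cross s 2, cross s 2, cross t 0, cross u 4, cap 1] :=
    calc
      [cup 1, cross s 2, cross t 0, cross u 4, cross s 2, cap 1]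
      _ ≈[4, 4] [cup 1, cross s 2, cross t 0, cross s 2, cross u 4, cap 1] :=
        .replace 3 (cross_comm (m := 6) s u (i := 2) (j := 4) (by omega) (by omega)).symm
      _ ≈[4, 4] [cup 1, cross s 2, cross s 2, cross t 0, cross u 4, cap 1] :=
        .replace 2 (cross_comm (m := 6) t s (i := 0) (j := 2) (by omega) (by omega))
  have hslide (s : Bool) := ((slide_cross_cup_cap s t u).symm.trans (hgather s)).localMove 4
  exact (hslide true).trans
    (.trans (.replace 1 (cross_cross_flip (n := 6) (i := 2) (by omega))) (hslide false).symm)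

theorem closureWord_alternating_flip (t u : Bool) :
    TangleEquiv (LocalMove 4) 0 0 (closureWord 3 [(1, false), (0, t), (1, false), (0, u)])
      (closureWord 3 [(1, true), (0, t), (1, true), (0, u)]) := by
  have hmove (s : Bool) : closureWord 3 [(1, s), (0, t), (1, s), (0, u)] ≈[0, 0]
      [cup 0, cup 1, cup 2, cross s 1, cross t 0, cross s 1, cross u 4, cap 2, cap 1, cap 0] :=
    .replace 6 (cross_caps u (n := 3) (i := 0) (j := 4) (by omega) (by omega))
  exact ((hmove false).localMove 4).trans
    (.trans (.replace 2 (circle_crosses_flip t u)) ((hmove true).localMove 4).symm)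

/-! ### The quotient of the braid group on three strands by fourth powers -/

section BraidRelation

variable {G : Type*} [Group G] {a b : G}

theorem isConj_of_semiconjBy {c x y : G} (h : SemiconjBy c x y) : IsConj x y :=
  ⟨toUnits c, h⟩

theorem isConj_mul_comm (x y : G) : IsConj (x * y) (y * x) :=
  isConj_of_semiconjBy (c := y) (mul_assoc y x y).symm

theorem isConj_mul_right_of_commute {x y z : G} (hz : ∀ g, Commute g z) (h : IsConj x y) :
    IsConj (x * z) (y * z) := by
  obtain ⟨c, hc⟩ := h
  exact ⟨c, hc.mul_right (hz c)⟩

/-- The full twist `(aba)²` on three strands, where `a` and `b` are the standard generators of the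
braid group. -/
def fullTwist (a b : G) : G := a * b * a * (a * b * a)

theorem semiconjBy_halfTwist_left (hab : a * b * a = b * a * b) : SemiconjBy (a * b * a) a b := by
  rw [SemiconjBy, ← mul_assoc, ← mul_assoc, hab]

theorem semiconjBy_halfTwist_right (hab : a * b * a = b * a * b) :
    SemiconjBy (a * b * a) b a :=
  hab ▸ semiconjBy_halfTwist_left hab.symm

theorem commute_fullTwist_left (hab : a * b * a = b * a * b) : Commute (fullTwist a b) a :=
  (semiconjBy_halfTwist_right hab).mul_left (semiconjBy_halfTwist_left hab)

theorem commute_fullTwist_right (hab : a * b * a = b * a * b) : Commute (fullTwist a b) b :=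
  (semiconjBy_halfTwist_left hab).mul_left (semiconjBy_halfTwist_right hab)

theorem fullTwist_comm (hab : a * b * a = b * a * b) : fullTwist a b = fullTwist b a := by
  rw [fullTwist, fullTwist, hab]

theorem fullTwist_eq_mul_pow_three (hab : a * b * a = b * a * b) :
    fullTwist a b = (a * b) ^ 3 := by
  rw [fullTwist]
  nth_rw 2 [hab]
  simp only [pow_succ, pow_zero, one_mul, mul_assoc]

theorem fullTwist_eq (hab : a * b * a = b * a * b) : fullTwist a b = a ^ 2 * b * a ^ 2 * b :=
  calc
    a * b * a * (a * b * a)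
    _ = a * b * (a * (a * b * a)) := mul_assoc ..
    _ = a * (b * (a * b * a)) * b := by
      rw [← (semiconjBy_halfTwist_right hab).eq]; simp only [mul_assoc]
    _ = a * (a * b * a * a) * b := by rw [(semiconjBy_halfTwist_left hab).eq]
    _ = a ^ 2 * b * a ^ 2 * b := by simp only [pow_two, mul_assoc]

theorem mul_sq_mul (hab : a * b * a = b * a * b) : b * a ^ 2 * b = (a ^ 2)⁻¹ * fullTwist a b := by
  simp only [fullTwist_eq hab, mul_assoc, inv_mul_cancel_left]

theorem inv_mul_fullTwist (hab : a * b * a = b * a * b) :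
    b⁻¹ * fullTwist a b = a ^ 2 * b * a ^ 2 := by
  rw [← (commute_fullTwist_right hab).inv_right.eq, fullTwist_eq hab, mul_inv_cancel_right]

theorem pow_four_right (hab : a * b * a = b * a * b) (ha : a ^ 4 = 1) : b ^ 4 = 1 := by
  have h : IsConj (a ^ 4) (b ^ 4) := (isConj_of_semiconjBy (semiconjBy_halfTwist_left hab)).pow 4
  rwa [ha, isConj_one_right] at h

theorem sq_mul_mul_sq_mul_inv (hab : a * b * a = b * a * b) (ha : a ^ 4 = 1) :
    a ^ 2 * b * a ^ 2 * b⁻¹ = b ^ 2 * fullTwist a b := by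
  have h : b⁻¹ * b⁻¹ = b ^ 2 := by
    rw [← mul_inv_rev, ← pow_two, inv_eq_iff_mul_eq_one, ← pow_add, pow_four_right hab ha]
  rw [← inv_mul_fullTwist hab, mul_assoc, (commute_fullTwist_right hab).inv_right.eq, ← mul_assoc,
    h]

theorem semiconjBy_sq_left (hab : a * b * a = b * a * b) (ha : a ^ 4 = 1) :
    SemiconjBy (a ^ 2) b (b⁻¹ * fullTwist a b) := by
  rw [SemiconjBy, inv_mul_fullTwist hab, mul_assoc _ (a ^ 2), ← pow_add, ha, mul_one]

theorem semiconjBy_sq_right (hab : a * b * a = b * a * b) (ha : a ^ 4 = 1) :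
    SemiconjBy (b ^ 2) a (a⁻¹ * fullTwist a b) :=
  fullTwist_comm hab ▸ semiconjBy_sq_left hab.symm (pow_four_right hab ha)

theorem fullTwist_pow_four (hab : a * b * a = b * a * b) (ha : a ^ 4 = 1) :
    fullTwist a b ^ 4 = 1 := by
  have h : IsConj (a ^ 4) ((a⁻¹ * fullTwist a b) ^ 4) :=
    (isConj_of_semiconjBy (semiconjBy_sq_right hab ha)).pow 4
  rwa [(commute_fullTwist_left hab).symm.inv_left.mul_pow, inv_pow, ha, inv_one, one_mul,
    isConj_one_right] at h

theorem mul_inv_mul (hab : a * b * a = b * a * b) (ha : a ^ 4 = 1) :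
    b * a⁻¹ * b = a⁻¹ * b * a⁻¹ * fullTwist a b := by
  have h : a⁻¹ = a * a ^ 2 := by rw [inv_eq_iff_mul_eq_one, ← pow_succ', ← pow_succ', ha]
  have hbab : b * a * b⁻¹ = a⁻¹ * b * a := by
    rw [mul_inv_eq_iff_eq_mul, mul_assoc, mul_assoc, eq_inv_mul_iff_mul_eq]
    simpa only [mul_assoc] using hab
  calc
    b * a⁻¹ * b
    _ = b * a * (a ^ 2 * b) := by rw [h]; simp only [mul_assoc]
    _ = b * a * b⁻¹ * fullTwist a b * a ^ 2 := by
      rw [(semiconjBy_sq_left hab ha).eq]; simp only [mul_assoc]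
    _ = a⁻¹ * b * (a * a ^ 2) * fullTwist a b := by
      rw [hbab, mul_assoc _ (fullTwist a b), ((commute_fullTwist_left hab).pow_right 2).eq]
      simp only [mul_assoc]
    _ = a⁻¹ * b * a⁻¹ * fullTwist a b := by rw [← h]

theorem inv_mul_mul_inv_mul (hab : a * b * a = b * a * b) (ha : a ^ 4 = 1) :
    b⁻¹ * a * b⁻¹ * a = a⁻¹ * b * fullTwist a b ^ 2 := by
  have hza := commute_fullTwist_left hab
  have hzb := (commute_fullTwist_right hab).inv_right
  calc
    b⁻¹ * a * b⁻¹ * a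
    _ = b⁻¹ * a * b⁻¹ * a * fullTwist a b ^ 4 := by rw [fullTwist_pow_four hab ha, mul_one]
    _ = b⁻¹ * fullTwist a b * a * (b⁻¹ * fullTwist a b) * a * fullTwist a b ^ 2 := by
      simp only [pow_succ, pow_zero, one_mul, mul_assoc, hza.left_comm, hzb.left_comm]
    _ = a⁻¹ * a ^ 3 * (b * a ^ 4 * a * b) * a ^ 3 * fullTwist a b ^ 2 := by
      rw [inv_mul_fullTwist hab]; group
    _ = a⁻¹ * a ^ 3 * (a * b * a) * a ^ 3 * fullTwist a b ^ 2 := by rw [ha, mul_one, hab]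
    _ = a⁻¹ * a ^ 4 * b * a ^ 4 * fullTwist a b ^ 2 := by group
    _ = a⁻¹ * b * fullTwist a b ^ 2 := by rw [ha, mul_one, mul_one]

theorem mul_inv_pow_three (hab : a * b * a = b * a * b) (ha : a ^ 4 = 1) :
    (a * b⁻¹) ^ 3 = fullTwist a b ^ 2 :=
  calc
    (a * b⁻¹) ^ 3
    _ = a * (b⁻¹ * a * b⁻¹ * a) * b⁻¹ := by simp only [pow_succ, pow_zero, one_mul, mul_assoc]
    _ = b * fullTwist a b ^ 2 * b⁻¹ := by
      rw [inv_mul_mul_inv_mul hab ha]; simp only [mul_assoc, mul_inv_cancel_left]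
    _ = fullTwist a b ^ 2 := by
      rw [((commute_fullTwist_right hab).pow_left 2).symm.eq, mul_inv_cancel_right]

theorem commute_fullTwist (hab : a * b * a = b * a * b) (hgen : Subgroup.closure {a, b} = ⊤)
    (x : G) : Commute x (fullTwist a b) := by
  have hle : Subgroup.closure {a, b} ≤ Subgroup.centralizer {fullTwist a b} := by
    rw [Subgroup.closure_le]
    rintro _ (rfl | rfl) <;> rw [SetLike.mem_coe, Subgroup.mem_centralizer_singleton_iff]
    exacts [(commute_fullTwist_left hab).eq.symm, (commute_fullTwist_right hab).eq.symm]
  exact (Subgroup.mem_centralizer_singleton_iff.1 (hle (hgen ▸ Subgroup.mem_top x)))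

theorem zpow_eq_of_pow_four_eq_one {x : G} (hx : x ^ 4 = 1) (k : ℤ) :
    x ^ k = 1 ∨ x ^ k = x ∨ x ^ k = x ^ 2 ∨ x ^ k = x⁻¹ := by
  have hinv : x⁻¹ = x ^ 3 := by rw [inv_eq_iff_mul_eq_one, ← pow_succ', hx]
  have hk : x ^ k = x ^ (k % 4) := zpow_eq_zpow_emod k (by exact_mod_cast hx)
  rw [hk, hinv]
  have h₀ := Int.emod_nonneg k four_ne_zero
  have h₁ := Int.emod_lt_of_pos k four_pos
  generalize k % 4 = r at h₀ h₁
  interval_cases r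
  exacts [.inl (zpow_zero x), .inr (.inl (zpow_one x)), .inr (.inr (.inl (zpow_ofNat x 2))),
    .inr (.inr (.inr (zpow_ofNat x 3)))]

theorem exists_mul_zpow_mul_eq (hab : a * b * a = b * a * b) (ha : a ^ 4 = 1) {r : G}
    (hr : r ∈ ({1, b, b ^ 2} : Set G)) (k : ℤ) :
    ∃ i : ℤ, ∃ r' ∈ ({1, b, b ^ 2} : Set G), ∃ k' j : ℤ,
      r * a ^ k * b = a ^ i * r' * a ^ k' * fullTwist a b ^ j := by
  obtain rfl | rfl | rfl := hr
  · exact ⟨k, b, by simp, 0, 0, by simp⟩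
  · rcases zpow_eq_of_pow_four_eq_one ha k with hk | hk | hk | hk <;> rw [hk]
    · exact ⟨0, r ^ 2, by simp, 0, 0, by simp [pow_two]⟩
    · exact ⟨1, r, by simp, 1, 0, by simp [hab]⟩
    · exact ⟨-2, 1, by simp, 0, 1, by simp [mul_sq_mul hab]⟩
    · exact ⟨-1, r, by simp, -1, 1, by simp [mul_inv_mul hab ha]⟩
  · refine ⟨2 - k, b, by simp, 2, k - 1, ?_⟩
    have hbinv : b ^ 2 * b = b⁻¹ := by
      rw [eq_inv_iff_mul_eq_one, ← pow_succ, ← pow_succ, pow_four_right hab ha]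
    have hz := (commute_fullTwist_right hab).inv_right
    calc
      b ^ 2 * a ^ k * b
      _ = (a⁻¹ * fullTwist a b) ^ k * (b ^ 2 * b) := by
        rw [((semiconjBy_sq_right hab ha).zpow_right k).eq, mul_assoc]
      _ = a ^ (-k) * (b⁻¹ * fullTwist a b ^ (k - 1 + 1)) := by
        rw [hbinv, (commute_fullTwist_left hab).symm.inv_left.mul_zpow, inv_zpow', mul_assoc,
          (hz.zpow_left k).eq, sub_add_cancel]
      _ = a ^ (-k) * (b⁻¹ * fullTwist a b) * fullTwist a b ^ (k - 1) := by
        rw [add_comm, zpow_one_add]; simp only [mul_assoc]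
      _ = a ^ (2 - k) * b * a ^ (2 : ℤ) * fullTwist a b ^ (k - 1) := by
        rw [inv_mul_fullTwist hab]; group

theorem exists_eq_zpow_mul (hab : a * b * a = b * a * b) (ha : a ^ 4 = 1)
    (hgen : Subgroup.closure {a, b} = ⊤) (x : G) :
    ∃ i : ℤ, ∃ r ∈ ({1, b, b ^ 2} : Set G), ∃ k j : ℤ,
      x = a ^ i * r * a ^ k * fullTwist a b ^ j := by
  let S : Set G := {x | ∃ i : ℤ, ∃ r ∈ ({1, b, b ^ 2} : Set G), ∃ k j : ℤ,
    x = a ^ i * r * a ^ k * fullTwist a b ^ j}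
  have hz (x : G) (j : ℤ) : Commute x (fullTwist a b ^ j) :=
    (commute_fullTwist hab hgen x).zpow_right j
  have mul_zpow_mem {x : G} (hx : x ∈ S) (m : ℤ) : x * a ^ m ∈ S := by
    obtain ⟨i, r, hr, k, j, rfl⟩ := hx
    exact ⟨i, r, hr, k + m, j, by rw [mul_assoc, ← (hz _ j).eq, zpow_add]; simp only [mul_assoc]⟩
  have mul_mem {x : G} (hx : x ∈ S) : x * b ∈ S := by
    obtain ⟨i, r, hr, k, j, rfl⟩ := hx
    obtain ⟨i', r', hr', k', j', h⟩ := exists_mul_zpow_mul_eq hab ha hr k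
    refine ⟨i + i', r', hr', k', j' + j, ?_⟩
    calc
      a ^ i * r * a ^ k * fullTwist a b ^ j * b
      _ = a ^ i * (r * a ^ k * b) * fullTwist a b ^ j := by
        rw [mul_assoc, ← (hz b j).eq]; simp only [mul_assoc]
      _ = a ^ (i + i') * r' * a ^ k' * fullTwist a b ^ (j' + j) := by
        rw [h, zpow_add, zpow_add]; simp only [mul_assoc]
  have hbinv : b⁻¹ = b * b * b := by
    rw [inv_eq_iff_mul_eq_one, ← pow_four_right hab ha]
    simp only [pow_succ', pow_zero, mul_one, mul_assoc]
  have hx : x ∈ Subgroup.closure {a, b} := hgen ▸ Subgroup.mem_top x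
  change x ∈ S
  induction hx using Subgroup.closure_induction_right with
  | one => exact ⟨0, 1, by simp, 0, 0, by simp⟩
  | mul_right x _ y hy ih =>
    obtain rfl | rfl := hy
    exacts [by simpa only [zpow_one] using mul_zpow_mem ih 1, mul_mem ih]
  | mul_inv_cancel x _ y hy ih =>
    obtain rfl | rfl := hy
    · simpa only [zpow_neg_one] using mul_zpow_mem ih (-1)
    · simpa only [hbinv, ← mul_assoc] using mul_mem (mul_mem (mul_mem ih))

theorem semiconjBy_sq_inv (hab : a * b * a = b * a * b) (ha : a ^ 4 = 1) :
    SemiconjBy (b ^ 2) a⁻¹ (a * (fullTwist a b)⁻¹) := by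
  simpa only [mul_inv_rev, inv_inv, (commute_fullTwist_left hab).inv_left.eq] using
    (semiconjBy_sq_right hab ha).inv_right

theorem isConj_inv_mul_zpow (hab : a * b * a = b * a * b) (ha : a ^ 4 = 1) (k : ℤ) :
    IsConj (a⁻¹ * b ^ k) (a * b ^ k * (fullTwist a b)⁻¹) := by
  rw [mul_assoc, ← ((commute_fullTwist_right hab).inv_left.zpow_right k).eq, ← mul_assoc]
  exact isConj_of_semiconjBy ((semiconjBy_sq_inv hab ha).mul_right
    (((Commute.refl b).pow_left 2).zpow_right k))

theorem isConj_mul_inv (hab : a * b * a = b * a * b) (ha : a ^ 4 = 1) :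
    IsConj (a * b⁻¹) (a * b * (fullTwist a b)⁻¹) := by
  rw [mul_assoc, fullTwist_comm hab]
  have hcomm : SemiconjBy (a ^ 2) a a := (Commute.refl a).pow_left 2
  exact isConj_of_semiconjBy
    (hcomm.mul_right (semiconjBy_sq_inv hab.symm (pow_four_right hab ha)))

theorem isConj_sq_mul_inv (hab : a * b * a = b * a * b) (ha : a ^ 4 = 1) :
    IsConj (a ^ 2 * b⁻¹) (a ^ 2 * b * (fullTwist a b)⁻¹) := by
  have h : b⁻¹ * a ^ 2 = a ^ 2 * b * (fullTwist a b)⁻¹ := by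
    rw [eq_mul_inv_iff_mul_eq, (semiconjBy_sq_left hab ha).eq, mul_assoc, mul_assoc,
      ((commute_fullTwist_left hab).pow_right 2).eq]
  exact h ▸ isConj_mul_comm (a ^ 2) b⁻¹

theorem isConj_sq_mul_sq (hab : a * b * a = b * a * b) (ha : a ^ 4 = 1) :
    IsConj (b ^ 2 * a ^ 2) (a ^ 2 * fullTwist a b) := by
  have h : b * a ^ 2 * b = a ^ 2 * fullTwist a b := by
    rw [mul_sq_mul hab, inv_eq_of_mul_eq_one_left (by rw [← pow_add, ha])]
  rw [pow_two b, mul_assoc]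
  exact h ▸ isConj_mul_comm b (b * a ^ 2)

theorem semiconjBy_sq_sq (hab : a * b * a = b * a * b) (ha : a ^ 4 = 1) :
    SemiconjBy (b ^ 2) (a ^ 2) (a ^ 2 * fullTwist a b ^ 2) := by
  have h : (a⁻¹ * fullTwist a b) ^ 2 = a ^ 2 * fullTwist a b ^ 2 := by
    rw [(commute_fullTwist_left hab).symm.inv_left.mul_pow, inv_pow,
      inv_eq_of_mul_eq_one_left (by rw [← pow_add, ha])]
  exact h ▸ (semiconjBy_sq_right hab ha).pow_right 2

theorem isConj_sq_mul (hab : a * b * a = b * a * b) (ha : a ^ 4 = 1) :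
    IsConj (a ^ 2 * b) (a ^ 2 * b * fullTwist a b ^ 2) := by
  rw [mul_assoc, ← ((commute_fullTwist_right hab).pow_left 2).eq, ← mul_assoc]
  exact isConj_of_semiconjBy
    ((semiconjBy_sq_sq hab ha).mul_right ((Commute.refl b).pow_left 2))

theorem exists_isConj_of_mul_zpow (hab : a * b * a = b * a * b) (ha : a ^ 4 = 1) {r : G}
    (hr : r ∈ ({1, b, b ^ 2} : Set G)) (k : ℤ) :
    ∃ r' ∈ ({1, a, a ^ 2, a ^ 2 * b, a * b} : Set G), ∃ j : ℤ,
      IsConj (r * a ^ k) (r' * fullTwist a b ^ j) := by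
  have hright := semiconjBy_halfTwist_right hab
  have hleft := semiconjBy_halfTwist_left hab
  rcases hr with rfl | rfl | rfl <;>
    rcases zpow_eq_of_pow_four_eq_one ha k with h | h | h | h <;> rw [h]
  · exact ⟨1, by simp, 0, by simp⟩
  · exact ⟨a, by simp, 0, by rw [zpow_zero, one_mul, mul_one]⟩
  · exact ⟨a ^ 2, by simp, 0, by rw [zpow_zero, one_mul, mul_one]⟩
  · exact ⟨a, by simp, -1, by
      simpa only [zpow_neg_one, one_mul] using isConj_of_semiconjBy (semiconjBy_sq_inv hab ha)⟩
  · exact ⟨a, by simp, 0, by simpa only [zpow_zero, mul_one] using isConj_of_semiconjBy hright⟩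
  · exact ⟨a * r, by simp, 0, by simpa only [zpow_zero, mul_one] using isConj_mul_comm r a⟩
  · exact ⟨a ^ 2 * r, by simp, 0, by
      simpa only [zpow_zero, mul_one] using isConj_mul_comm r (a ^ 2)⟩
  · exact ⟨a * r, by simp, -1, by
      simpa only [zpow_neg_one, zpow_one] using
        (isConj_mul_comm r a⁻¹).trans (by simpa only [zpow_one] using isConj_inv_mul_zpow hab ha 1)⟩
  · exact ⟨a ^ 2, by simp, 0, by
      simpa only [zpow_zero, mul_one] using isConj_of_semiconjBy (hright.pow_right 2)⟩
  · exact ⟨a ^ 2 * b, by simp, 0, by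
      simpa only [zpow_zero, mul_one] using
        isConj_of_semiconjBy ((hright.pow_right 2).mul_right hleft)⟩
  · exact ⟨a ^ 2, by simp, 1, by simpa only [zpow_one] using isConj_sq_mul_sq hab ha⟩
  · exact ⟨a ^ 2 * b, by simp, -1, by
      simpa only [zpow_neg_one] using (isConj_of_semiconjBy
        ((hright.pow_right 2).mul_right hleft.inv_right)).trans (isConj_sq_mul_inv hab ha)⟩

theorem exists_isConj_mul_zpow (hab : a * b * a = b * a * b) (ha : a ^ 4 = 1)
    (hgen : Subgroup.closure {a, b} = ⊤) (x : G) :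
    ∃ r ∈ ({1, a, a ^ 2, a ^ 2 * b, a * b} : Set G), ∃ j : ℤ,
      IsConj x (r * fullTwist a b ^ j) := by
  obtain ⟨i, r, hr, k, j, rfl⟩ := exists_eq_zpow_mul hab ha hgen x
  obtain ⟨r', hr', l, h⟩ := exists_isConj_of_mul_zpow hab ha hr (k + i)
  have hcomm := isConj_mul_comm (a ^ i) (r * a ^ k)
  rw [← mul_assoc, mul_assoc r, ← zpow_add] at hcomm
  refine ⟨r', hr', l + j, ?_⟩
  rw [zpow_add, ← mul_assoc]
  exact isConj_mul_right_of_commute (fun g => (commute_fullTwist hab hgen g).zpow_right j)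
    (hcomm.trans h)

end BraidRelation

/-! ### Braids up to moves -/

/-- The congruence on braid words generated by isotopies and `N`-moves of the tangles which they
represent. -/
def braidCon (N n : ℕ) : Con (FreeMonoid (Fin (n - 1) × Bool)) where
  r β γ := TangleEquiv (LocalMove N) (2 * n) (2 * n) (braidSlices β.toList) (braidSlices γ.toList)
  iseqv := ⟨fun _ => refl .., TangleEquiv.symm, TangleEquiv.trans⟩
  mul' {β β' γ γ'} h h' := by
    simp only [FreeMonoid.toList_mul, braidSlices_append]
    exact (h.append_right (isTangle_braidSlices (by omega) _)).trans
      (h'.append_left (isTangle_braidSlices (by omega) _))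

/-- The braids on `n` strands up to `N`-moves, where braids are regarded as tangles. -/
def BraidQuotient (N n : ℕ) : Type := (braidCon N n).Quotient

namespace BraidQuotient

variable {N n : ℕ}

instance : Monoid (BraidQuotient N n) := inferInstanceAs (Monoid (braidCon N n).Quotient)

/-- The class of a braid word. -/
def mk (N : ℕ) {n : ℕ} (β : BraidWord n) : BraidQuotient N n :=
  (braidCon N n).mk' (FreeMonoid.ofList β)

theorem mk_eq_mk {β γ : BraidWord n} : mk N β = mk N γ ↔
    TangleEquiv (LocalMove N) (2 * n) (2 * n) (braidSlices β) (braidSlices γ) :=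
  (braidCon N n).eq

theorem mk_nil : mk N ([] : BraidWord n) = 1 := rfl

theorem mk_append (β γ : BraidWord n) : mk N (β ++ γ) = mk N β * mk N γ := rfl

theorem mk_surjective : Function.Surjective (mk N : BraidWord n → BraidQuotient N n) :=
  Quotient.mk_surjective

theorem mk_cross_mul_mk_cross_not (i : Fin (n - 1)) (s : Bool) :
    mk N [(i, s)] * mk N [(i, !s)] = 1 := by
  have := i.2
  refine mk_eq_mk.2 (localMove ?_ N)
  change [cross s i, cross (!s) i] ≈[2 * n, 2 * n] []
  exact move 0 (r2 s i)

theorem isUnit_mk (β : BraidWord n) : IsUnit (mk N β) := by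
  induction β with
  | nil => exact isUnit_one
  | cons g β ih =>
    have h := mk_cross_mul_mk_cross_not (N := N) g.1 (!g.2)
    rw [Bool.not_not] at h
    exact IsUnit.mul ⟨⟨_, _, mk_cross_mul_mk_cross_not g.1 g.2, h⟩, rfl⟩ ih

noncomputable instance : Group (BraidQuotient N n) :=
  groupOfIsUnit (mk_surjective.forall.2 isUnit_mk)

/-- The standard generator `σ_{i+1}`. -/
def gen (N : ℕ) {n : ℕ} (i : Fin (n - 1)) : BraidQuotient N n := mk N [(i, true)]

theorem mk_cons_true (i : Fin (n - 1)) (β : BraidWord n) :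
    mk N ((i, true) :: β) = gen N i * mk N β :=
  rfl

theorem inv_gen (i : Fin (n - 1)) : (gen N i)⁻¹ = mk N [(i, false)] :=
  inv_eq_of_mul_eq_one_right (mk_cross_mul_mk_cross_not i true)

theorem mk_cons_false (i : Fin (n - 1)) (β : BraidWord n) :
    mk N ((i, false) :: β) = (gen N i)⁻¹ * mk N β := by
  rw [inv_gen]
  rfl

theorem gen_mul_gen_mul_gen {i j : Fin (n - 1)} (h : (j : ℕ) = i + 1) :
    gen N i * gen N j * gen N i = gen N j * gen N i * gen N j := by
  have := j.2
  refine mk_eq_mk.2 (localMove ?_ N)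
  change [σ i, σ j, σ i] ≈[2 * n, 2 * n] [σ j, σ i, σ j]
  rw [h]
  exact move 0 (r3 true i)

theorem gen_pow (i : Fin (n - 1)) : gen N i ^ N = 1 := by
  have hmk (k : ℕ) : gen N i ^ k = mk N (List.replicate k (i, true)) := by
    induction k with
    | zero => exact pow_zero _
    | succ k ih => rw [pow_succ', ih]; rfl
  rw [hmk, ← mk_nil, mk_eq_mk, braidSlices, braidSlices, List.map_replicate]
  exact (replicate_cross N (by omega) true).symm

theorem closure_range_gen :
    Subgroup.closure (Set.range (gen N : Fin (n - 1) → BraidQuotient N n)) = ⊤ := by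
  rw [eq_top_iff]
  rintro x -
  obtain ⟨β, rfl⟩ := mk_surjective x
  induction β with
  | nil => exact one_mem _
  | cons g β ih =>
    obtain ⟨i, s⟩ := g
    have hi : gen N i ∈ Subgroup.closure (Set.range (gen N : Fin (n - 1) → BraidQuotient N n)) :=
      Subgroup.subset_closure ⟨i, rfl⟩
    cases s
    · exact mk_cons_false (N := N) i β ▸ mul_mem (inv_mem hi) ih
    · exact mk_cons_true (N := N) i β ▸ mul_mem hi ih

end BraidQuotient

/-- The links up to `N`-move equivalence. -/
def MoveClass (N : ℕ) : Type :=
  Quotient (Relation.EqvGen.setoid fun L L' => Step ReidemeisterMove L L' ∨ Step (TwistMove N) L L')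

/-- The class of a link up to `N`-move equivalence. -/
def MoveClass.mk (N : ℕ) (L : LinkDiagram) : MoveClass N := Quotient.mk _ L

theorem MoveClass.mk_eq_mk {N : ℕ} {L L' : LinkDiagram} :
    MoveClass.mk N L = MoveClass.mk N L' ↔ MoveEquiv N L L' :=
  Quotient.eq

theorem TangleEquiv.moveClass_eq {N : ℕ} {L L' : LinkDiagram}
    (h : TangleEquiv (LocalMove N) 0 0 L.1 L'.1) : MoveClass.mk N L = MoveClass.mk N L' :=
  MoveClass.mk_eq_mk.2 (h.moveEquiv L.2 L'.2)

namespace BraidQuotient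

variable {N n : ℕ}

/-- The closure of a braid, up to `N`-move equivalence. -/
def closureClass : BraidQuotient N n → MoveClass N :=
  Quotient.lift (fun β => MoveClass.mk N (closure n β.toList)) fun _ _ h =>
    (h.context (isTangle_zero_cups n) (isTangle_caps_zero n)).moveClass_eq

theorem closureClass_mk (β : BraidWord n) :
    closureClass (mk N β) = MoveClass.mk N (closure n β) :=
  rfl

theorem closureClass_mul_comm (x y : BraidQuotient N n) :
    closureClass (x * y) = closureClass (y * x) := by
  obtain ⟨β, rfl⟩ := mk_surjective x
  obtain ⟨γ, rfl⟩ := mk_surjective y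
  exact ((closureWord_append_comm β γ).localMove N).moveClass_eq (L := closure n (β ++ γ))
    (L' := closure n (γ ++ β))

theorem closureClass_eq_of_isConj {x y : BraidQuotient N n} (h : IsConj x y) :
    closureClass x = closureClass y := by
  obtain ⟨c, rfl⟩ := isConj_iff.1 h
  rw [closureClass_mul_comm, inv_mul_cancel_left]

end BraidQuotient

/-! ### Closed 3-braids -/

/-- The links which represent the classes of closed 3-braids with `k` components up to 4-moves. -/
def basicLinks : ℕ → Set LinkDiagram
  | 1 => {unknot}
  | 2 => {trivialLink 2, hopfLink}
  | 3 => {trivialLink 3, splitUnion hopfLink unknot, hopfSum, torusLink33, borromeanRings}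
  | _ => ∅

namespace BraidQuotient

section Closures

variable (N : ℕ) {n : ℕ}

theorem closureClass_stabilization (β : BraidWord (n + 1)) (s : Bool) :
    closureClass (mk N (addStrand β ++ ([(Fin.last n, s)] : BraidWord (n + 2)))) =
      closureClass (mk N β) :=
  ((closureWord_stabilization β s).localMove N).moveClass_eq
    (L := closure (n + 2) (addStrand β ++ ([(Fin.last n, s)] : BraidWord (n + 2))))
    (L' := closure (n + 1) β)

theorem closureClass_addStrand (β : BraidWord n) :
    closureClass (mk N (n := n + 1) (addStrand β)) =
      MoveClass.mk N (splitUnion (closure n β) unknot) :=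
  ((closureWord_addStrand β).localMove N).moveClass_eq
    (L := closure (n + 1) (addStrand β)) (L' := splitUnion (closure n β) unknot)

theorem closureClass_one : closureClass (1 : BraidQuotient N n) = MoveClass.mk N (trivialLink n) :=
  ((closureWord_nil n).localMove N).moveClass_eq (L := closure n [])

theorem closureClass_cross_zero_cross_one (s t : Bool) :
    closureClass (mk N (n := 3) [(0, s), (1, t)]) = MoveClass.mk N unknot :=
  calc
    closureClass (mk N (n := 3) [(0, s), (1, t)])
    _ = closureClass (mk N (n := 2) [(0, s)]) := closureClass_stabilization N (n := 1) [(0, s)] t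
    _ = closureClass (mk N (n := 1) []) := closureClass_stabilization N [] s
    _ = MoveClass.mk N unknot := closureClass_one N

theorem closureClass_cross_one (s : Bool) :
    closureClass (mk N (n := 3) [(1, s)]) = MoveClass.mk N (trivialLink 2) :=
  (closureClass_stabilization N [] s).trans (closureClass_one N)

end Closures

local notation "σ₁" => (gen 4 0 : BraidQuotient 4 3)

local notation "σ₂" => (gen 4 1 : BraidQuotient 4 3)

local notation "Δ²" => fullTwist σ₁ σ₂

theorem braid_relation : σ₁ * σ₂ * σ₁ = σ₂ * σ₁ * σ₂ := gen_mul_gen_mul_gen rfl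

theorem closure_pair_gen : Subgroup.closure {σ₁, σ₂} = ⊤ := by
  rw [← closure_range_gen]
  congr 1 with x
  exact ((Fin.exists_fin_two (p := fun i => gen 4 i = x)).trans (or_congr eq_comm eq_comm)).symm

theorem fullTwist_zpow_neg_two : Δ² ^ (-2 : ℤ) = Δ² ^ 2 := by
  rw [zpow_neg, zpow_ofNat, inv_eq_iff_mul_eq_one, ← pow_add]
  exact fullTwist_pow_four braid_relation (gen_pow 0)

theorem forall_fullTwist_zpow {p : BraidQuotient 4 3 → Prop} (zero : p (Δ² ^ (0 : ℤ)))
    (one : p (Δ² ^ (1 : ℤ))) (neg_one : p (Δ² ^ (-1 : ℤ))) (neg_two : p (Δ² ^ (-2 : ℤ))) (j : ℤ) :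
    p (Δ² ^ j) := by
  rw [zpow_zero] at zero
  rw [zpow_one] at one
  rw [zpow_neg_one] at neg_one
  rw [fullTwist_zpow_neg_two] at neg_two
  rcases zpow_eq_of_pow_four_eq_one (fullTwist_pow_four braid_relation (gen_pow 0)) j with
    h | h | h | h <;> rwa [h]

theorem closureClass_mul_fullTwist_zpow_of_isConj {x y : BraidQuotient 4 3} {i j k : ℤ}
    (h : IsConj x (y * Δ² ^ i)) (hk : i + j = k := by norm_num) :
    closureClass (x * Δ² ^ j) = closureClass (y * Δ² ^ k) := by
  rw [← hk, zpow_add, ← mul_assoc]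
  exact closureClass_eq_of_isConj <| isConj_mul_right_of_commute
    (fun g => (commute_fullTwist braid_relation closure_pair_gen g).zpow_right j) h

theorem mk_addStrand_replicate (n : ℕ) :
    mk 4 (n := 3) (addStrand (List.replicate n (0, true) : BraidWord 2)) = σ₁ ^ n := by
  induction n with
  | zero => rfl
  | succ n ih => rw [pow_succ', ← ih]; rfl

theorem closureClass_gen_pow_mul_fullTwist (n : ℕ) :
    closureClass (σ₁ ^ n * Δ² ^ (1 : ℤ)) = closureClass (σ₁ ^ n * Δ² ^ (-1 : ℤ)) := by
  have h := ((closureWord_flip (List.replicate (n + 2) (0, true))).localMove 4).moveClass_eq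
    (L := closure 3 _) (L' := closure 3 _)
  have hpos : mk 4 (n := 3) [(1, true), (0, true), (0, true), (1, true)] = (σ₁ ^ 2)⁻¹ * Δ² := by
    rw [← mul_sq_mul braid_relation]
    simp only [mk_cons_true, mk_nil, mul_one, pow_two, mul_assoc]
  have hneg : mk 4 (n := 3) [(1, false), (0, false), (0, false), (1, false)] =
      ((σ₁ ^ 2)⁻¹ * Δ²)⁻¹ := by
    rw [← mul_sq_mul braid_relation]
    simp only [mk_cons_false, mk_nil, mul_one, pow_two, mul_assoc, mul_inv_rev]
  have hcomm := ((commute_fullTwist_left braid_relation).inv_left.pow_right 2).eq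
  rw [← closureClass_mk, ← closureClass_mk, mk_append, mk_append, hpos, hneg,
    mk_addStrand_replicate, mul_inv_rev, inv_inv, hcomm, ← mul_assoc, ← mul_assoc,
    pow_add, mul_inv_cancel_right, mul_assoc (σ₁ ^ n), ← pow_add, gen_pow, mul_one] at h
  simpa only [zpow_one, zpow_neg_one] using h

theorem closureClass_fullTwist_zpow (j : ℤ) :
    closureClass (Δ² ^ j) ∈ MoveClass.mk 4 '' basicLinks 3 := by
  have hpos : closureClass (Δ² ^ (1 : ℤ)) = MoveClass.mk 4 torusLink33 := by
    rw [zpow_one, fullTwist_eq_mul_pow_three braid_relation]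
    rfl
  have hneg : closureClass (Δ² ^ (-1 : ℤ)) = MoveClass.mk 4 torusLink33 := by
    simpa only [pow_zero, one_mul, hpos] using (closureClass_gen_pow_mul_fullTwist 0).symm
  have hneg_two : closureClass (Δ² ^ (-2 : ℤ)) = MoveClass.mk 4 borromeanRings := by
    rw [fullTwist_zpow_neg_two, ← mul_inv_pow_three braid_relation (gen_pow 0), inv_gen]
    rfl
  refine forall_fullTwist_zpow (p := fun z => closureClass z ∈ _) ?_ ?_ ?_ ?_ j
  · exact ⟨trivialLink 3, by simp [basicLinks], (closureClass_one 4).symm⟩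
  · exact ⟨torusLink33, by simp [basicLinks], hpos.symm⟩
  · exact ⟨torusLink33, by simp [basicLinks], hneg.symm⟩
  · exact ⟨borromeanRings, by simp [basicLinks], hneg_two.symm⟩

theorem closureClass_gen_mul_fullTwist_zpow (j : ℤ) :
    closureClass (σ₁ * Δ² ^ j) = MoveClass.mk 4 (trivialLink 2) := by
  have hσ : SemiconjBy (σ₁ * σ₂ * σ₁) σ₁ σ₂ := semiconjBy_halfTwist_left braid_relation
  have hinv : IsConj σ₁⁻¹ (σ₁ * Δ² ^ (-1 : ℤ)) := by
    simpa only [zpow_neg_one] using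
      isConj_of_semiconjBy (semiconjBy_sq_inv braid_relation (gen_pow 0))
  have hzero : closureClass (σ₁ * Δ² ^ (0 : ℤ)) = MoveClass.mk 4 (trivialLink 2) := by
    rw [zpow_zero, mul_one, closureClass_eq_of_isConj (isConj_of_semiconjBy hσ)]
    exact closureClass_cross_one 4 true
  have hneg : closureClass (σ₁ * Δ² ^ (-1 : ℤ)) = MoveClass.mk 4 (trivialLink 2) := by
    rw [← closureClass_eq_of_isConj hinv,
      closureClass_eq_of_isConj (isConj_of_semiconjBy hσ.inv_right), inv_gen]
    exact closureClass_cross_one 4 false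
  have hpos : closureClass (σ₁ * Δ² ^ (1 : ℤ)) = MoveClass.mk 4 (trivialLink 2) := by
    simpa only [pow_one, hneg] using closureClass_gen_pow_mul_fullTwist 1
  have hneg_two : closureClass (σ₁ * Δ² ^ (-2 : ℤ)) = MoveClass.mk 4 (trivialLink 2) := by
    have hcube : σ₁ ^ 3 = σ₁⁻¹ := by rw [eq_inv_iff_mul_eq_one, ← pow_succ, gen_pow]
    have hflip := closureClass_gen_pow_mul_fullTwist 3
    rw [hcube, closureClass_mul_fullTwist_zpow_of_isConj (k := 0) hinv, hzero] at hflip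
    rw [hflip, ← closureClass_mul_fullTwist_zpow_of_isConj hinv (j := -1)]
  exact forall_fullTwist_zpow (p := fun z => closureClass (σ₁ * z) = _) hzero hpos hneg hneg_two j

theorem closureClass_sq_mul_fullTwist_zpow (j : ℤ) :
    closureClass (σ₁ ^ 2 * Δ² ^ j) ∈ MoveClass.mk 4 '' basicLinks 3 := by
  have hconj : IsConj (σ₁ ^ 2) (σ₁ ^ 2 * Δ² ^ (2 : ℤ)) := by
    simpa only [zpow_ofNat] using
      isConj_of_semiconjBy (semiconjBy_sq_sq braid_relation (gen_pow 0))
  have hzero : closureClass (σ₁ ^ 2 * Δ² ^ (0 : ℤ)) =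
      MoveClass.mk 4 (splitUnion hopfLink unknot) := by
    rw [zpow_zero, mul_one, pow_two]
    exact closureClass_addStrand 4 (n := 2) [(0, true), (0, true)]
  have hneg_two := hzero ▸ closureClass_mul_fullTwist_zpow_of_isConj (j := -2) (k := 0) hconj
  have hpos : closureClass (σ₁ ^ 2 * Δ² ^ (1 : ℤ)) = MoveClass.mk 4 hopfSum := by
    have hσ : SemiconjBy (σ₁ * σ₂ * σ₁) (σ₂ ^ 2) (σ₁ ^ 2) :=
      (semiconjBy_halfTwist_right braid_relation).pow_right 2
    rw [← closureClass_mul_fullTwist_zpow_of_isConj (x := σ₂ ^ 2) (i := 0) (j := 1) (by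
      simpa only [zpow_zero, mul_one] using isConj_of_semiconjBy hσ), zpow_one,
      ← sq_mul_mul_sq_mul_inv braid_relation (gen_pow 0), pow_two, inv_gen]
    exact (closureWord_hopfSum.localMove 4).moveClass_eq (L := closure 3 _)
  have hneg := hpos ▸ closureClass_mul_fullTwist_zpow_of_isConj (j := -1) (k := 1) hconj
  refine forall_fullTwist_zpow (p := fun z => closureClass (σ₁ ^ 2 * z) ∈ _) ?_ ?_ ?_ ?_ j
  · exact ⟨splitUnion hopfLink unknot, by simp [basicLinks], hzero.symm⟩
  · exact ⟨hopfSum, by simp [basicLinks], hpos.symm⟩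
  · exact ⟨hopfSum, by simp [basicLinks], hneg.symm⟩
  · exact ⟨splitUnion hopfLink unknot, by simp [basicLinks], hneg_two.symm⟩

theorem closureClass_sq_mul_mul_fullTwist_zpow (j : ℤ) :
    closureClass (σ₁ ^ 2 * σ₂ * Δ² ^ j) = MoveClass.mk 4 hopfLink := by
  have hconj : IsConj (σ₁ ^ 2 * σ₂) (σ₁ ^ 2 * σ₂ * Δ² ^ (2 : ℤ)) := by
    simpa only [zpow_ofNat] using isConj_sq_mul braid_relation (gen_pow 0)
  have hzero : closureClass (σ₁ ^ 2 * σ₂ * Δ² ^ (0 : ℤ)) = MoveClass.mk 4 hopfLink := by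
    rw [zpow_zero, mul_one, pow_two]
    exact closureClass_stabilization 4 (n := 1) [(0, true), (0, true)] true
  have hneg : closureClass (σ₁ ^ 2 * σ₂ * Δ² ^ (-1 : ℤ)) = MoveClass.mk 4 hopfLink := by
    rw [zpow_neg_one,
      ← closureClass_eq_of_isConj (isConj_sq_mul_inv braid_relation (gen_pow 0)), pow_two, inv_gen]
    exact closureClass_stabilization 4 (n := 1) [(0, true), (0, true)] false
  have hpos := hneg ▸ closureClass_mul_fullTwist_zpow_of_isConj (j := -1) (k := 1) hconj
  have hneg_two := hzero ▸ closureClass_mul_fullTwist_zpow_of_isConj (j := -2) (k := 0) hconj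
  exact forall_fullTwist_zpow (p := fun z => closureClass (σ₁ ^ 2 * σ₂ * z) = _) hzero
    hpos.symm hneg hneg_two j

theorem closureClass_mul_mul_fullTwist_zpow (j : ℤ) :
    closureClass (σ₁ * σ₂ * Δ² ^ j) = MoveClass.mk 4 unknot := by
  have hright : IsConj (σ₁⁻¹ * σ₂) (σ₁ * σ₂ * Δ² ^ (-1 : ℤ)) := by
    simpa only [zpow_neg_one, zpow_one] using isConj_inv_mul_zpow braid_relation (gen_pow 0) 1
  have hleft : IsConj (σ₁ * σ₂⁻¹) (σ₁ * σ₂ * Δ² ^ (-1 : ℤ)) := by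
    simpa only [zpow_neg_one] using isConj_mul_inv braid_relation (gen_pow 0)
  have hinv : IsConj (σ₁⁻¹ * σ₂⁻¹) (σ₁ * σ₂⁻¹ * Δ² ^ (-1 : ℤ)) := by
    simpa only [zpow_neg_one] using isConj_inv_mul_zpow braid_relation (gen_pow 0) (-1)
  have hzero : closureClass (σ₁ * σ₂ * Δ² ^ (0 : ℤ)) = MoveClass.mk 4 unknot := by
    rw [zpow_zero, mul_one]
    exact closureClass_cross_zero_cross_one 4 true true
  have hneg : closureClass (σ₁ * σ₂ * Δ² ^ (-1 : ℤ)) = MoveClass.mk 4 unknot := by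
    rw [← closureClass_eq_of_isConj hleft, inv_gen]
    exact closureClass_cross_zero_cross_one 4 true false
  have hneg_two : closureClass (σ₁ * σ₂ * Δ² ^ (-2 : ℤ)) = MoveClass.mk 4 unknot := by
    rw [← closureClass_mul_fullTwist_zpow_of_isConj hleft (j := -1),
      ← closureClass_eq_of_isConj hinv, inv_gen, inv_gen]
    exact closureClass_cross_zero_cross_one 4 false false
  have hpos : closureClass (σ₁ * σ₂ * Δ² ^ (1 : ℤ)) = MoveClass.mk 4 unknot := by
    have hcube : σ₂ ^ 3 = σ₂⁻¹ := by rw [eq_inv_iff_mul_eq_one, ← pow_succ, gen_pow]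
    have hbraid : σ₂ * σ₁ * σ₂ * σ₁ = σ₂ ^ 2 * (σ₁ * σ₂) := by
      rw [mul_assoc, mul_assoc, ← mul_assoc σ₁, braid_relation, pow_two]
      simp only [mul_assoc]
    calc
      closureClass (σ₁ * σ₂ * Δ² ^ (1 : ℤ))
      _ = closureClass (σ₂⁻¹ * σ₁ * σ₂⁻¹ * σ₁) := by
        rw [← closureClass_mul_fullTwist_zpow_of_isConj hright (j := 2), zpow_ofNat,
          ← inv_mul_mul_inv_mul braid_relation (gen_pow 0)]
      _ = closureClass (σ₂ * σ₁ * σ₂ * σ₁) := by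
        rw [inv_gen]
        exact (closureWord_alternating_flip true true).moveClass_eq (L := closure 3 _)
          (L' := closure 3 _)
      _ = closureClass (σ₁ * σ₂⁻¹) := by
        rw [hbraid, closureClass_mul_comm, mul_assoc, ← pow_succ', hcube]
      _ = MoveClass.mk 4 unknot := by
        rw [inv_gen]
        exact closureClass_cross_zero_cross_one 4 true false
  exact forall_fullTwist_zpow (p := fun z => closureClass (σ₁ * σ₂ * z) = _) hzero hpos hneg
    hneg_two j

theorem exists_closureClass_mem (x : BraidQuotient 4 3) :
    ∃ k, closureClass x ∈ MoveClass.mk 4 '' basicLinks k := by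
  obtain ⟨r, hr, j, h⟩ := exists_isConj_mul_zpow braid_relation (gen_pow 0) closure_pair_gen x
  rw [closureClass_eq_of_isConj h]
  obtain rfl | rfl | rfl | rfl | rfl := hr
  · exact ⟨3, (one_mul (Δ² ^ j)).symm ▸ closureClass_fullTwist_zpow j⟩
  · exact ⟨2, trivialLink 2, by simp [basicLinks], (closureClass_gen_mul_fullTwist_zpow j).symm⟩
  · exact ⟨3, closureClass_sq_mul_fullTwist_zpow j⟩
  · exact ⟨2, hopfLink, by simp [basicLinks], (closureClass_sq_mul_mul_fullTwist_zpow j).symm⟩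
  · exact ⟨1, unknot, by simp [basicLinks], (closureClass_mul_mul_fullTwist_zpow j).symm⟩

end BraidQuotient

theorem numComponents_of_mem_basicLinks {k : ℕ} {L : LinkDiagram} (h : L ∈ basicLinks k) :
    L.numComponents = k := by
  match k, h with
  | 1, h =>
    cases h
    exact numComponents_eq_of_numColourings_eq (by decide)
  | 2, h => rcases h with rfl | rfl <;> exact numComponents_eq_of_numColourings_eq (by decide)
  | 3, h =>
    rcases h with rfl | rfl | rfl | rfl | rfl <;>
      exact numComponents_eq_of_numColourings_eq (by decide)

theorem exists_basicLink_moveEquiv {L : LinkDiagram} (h : L.IsClosedBraid 3) :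
    ∃ M ∈ basicLinks L.numComponents, MoveEquiv 4 L M := by
  obtain ⟨β, hβ⟩ := h
  obtain ⟨k, M, hM, hβM⟩ := (BraidQuotient.mk 4 β).exists_closureClass_mem
  have hLM : MoveEquiv 4 L M :=
    (Relation.EqvGen.mono (fun _ _ => .inl) _ _ hβ).trans _ _ _
      (MoveClass.mk_eq_mk.1 hβM.symm)
  rw [numComponents_eq_of_moveEquiv (by decide) hLM, numComponents_of_mem_basicLinks hM]
  exact ⟨M, hM, hLM⟩

end LinkDiagram

theorem theorem1p14 :
    (∀ L : LinkDiagram, L.IsClosedBraid 3 → L.numComponents = 1 →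
      LinkDiagram.MoveEquiv 4 L LinkDiagram.unknot) ∧
    (∀ L : LinkDiagram, L.IsClosedBraid 3 → L.numComponents = 2 →
      LinkDiagram.MoveEquiv 4 L (LinkDiagram.trivialLink 2) ∨
      LinkDiagram.MoveEquiv 4 L LinkDiagram.hopfLink) ∧
    (∀ L : LinkDiagram, L.IsClosedBraid 3 → L.numComponents = 3 →
      LinkDiagram.MoveEquiv 4 L (LinkDiagram.trivialLink 3) ∨
      LinkDiagram.MoveEquiv 4 L
        (LinkDiagram.splitUnion LinkDiagram.hopfLink LinkDiagram.unknot) ∨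
      LinkDiagram.MoveEquiv 4 L LinkDiagram.hopfSum ∨
      LinkDiagram.MoveEquiv 4 L LinkDiagram.torusLink33 ∨
      LinkDiagram.MoveEquiv 4 L LinkDiagram.borromeanRings) := by
  have classification {k : ℕ} (L : LinkDiagram) (hL : L.IsClosedBraid 3)
      (hk : L.numComponents = k) : ∃ M ∈ LinkDiagram.basicLinks k, LinkDiagram.MoveEquiv 4 L M :=
    hk ▸ LinkDiagram.exists_basicLink_moveEquiv hL
  refine ⟨fun L hL hk => ?_, fun L hL hk => ?_, fun L hL hk => ?_⟩
  · obtain ⟨M, rfl, h⟩ := classification L hL hk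
    exact h
  · obtain ⟨M, rfl | rfl, h⟩ := classification L hL hk
    exacts [.inl h, .inr h]
  · obtain ⟨M, rfl | rfl | rfl | rfl | rfl, h⟩ := classification L hL hk
    exacts [.inl h, .inr (.inl h), .inr (.inr (.inl h)), .inr (.inr (.inr (.inl h))),
      .inr (.inr (.inr (.inr h)))]
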